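/- Let $G$ be a locally compact abelian (Hausdorff) group, written additively, with a (Radon) Haar measure. Let $L^\infty(G)$ be the space of complex functions on $G$ that are locally Borel measurable (preimages of Borel sets meet every Borel set of finite measure in a Borel set) and bounded outside a locally null set, modulo equality outside locally null sets (sets meeting every Borel set of finite measure in a null set), with $\|\cdot\|_\infty$ the corresponding essential supremum norm. For $y\in G$ let $\alpha_y(f)(x)=f(x-y)$. Define the following subsets of $L^\infty(G)$: - $\operatorname{BUC}(G)$: the (classes of) bounded uniformly continuous functions on $G$. - $B_0(G)$: all $f\in L^\infty(G)$ such that for every $\varepsilon>0$ there is a compact $K\subset G$ with $\|f\chi_{G\setminus K}\|_\infty<\varepsilon$. - $\operatorname{SO}(G)$: all $f\in L^\infty(G)$ such that for every $\varepsilon>0$ there are a compact $K\subset G$ and a neighborhood $O$ of $0$ with $\|(f-\alpha_y(f))\chi_{G\setminus K}\|_\infty<\varepsilon$ for all $y\in O$. Let $\sigma G$ be the maximal ideal space of the algebra $\operatorname{BUC}(G)$, identify $x\in G$ with the evaluation functional $\delta_x\in\sigma G$, and put $\partial G=\sigma G\setminus G$. Let $\tau_{u.c.}$ be the topology on $L^\infty(G)$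 of uniform convergence on compact sets, given by the seminorms $f\mapsto\|f\chi_K\|_\infty$, $K\subset G$ compact. Let $\operatorname{BUC}(G)_1(\tau_{u.c.})$ be the set of all $f\in L^\infty(G)$ such that 1. for every $x\in\partial G$ and every net $(x_\gamma)\subset G$ with $x_\gamma\to x$ in $\sigma G$, the limit $\alpha_x(f)=\lim_\gamma\alpha_{x_\gamma}(f)$ exists in $L^\infty(G)$ with respect to $\tau_{u.c.}$ (it then depends only on $x$); 2. $\alpha_x(f)\in\operatorname{BUC}(G)$ for every $x\in\partial G$; 3. the family $\{\alpha_x(f):x\in\partial G\}$ is uniformly equicontinuous: for every $\varepsilon>0$ there is a neighborhood $O$ of $0$ with $\|\alpha_y(\alpha_x(f))-\alpha_x(f)\|_\infty<\varepsilon$ for all $y\in O$ and $x\in\partial G$. Then $$\operatorname{SO}(G)=\operatorname{BUC}(G)+B_0(G)\qquad\text{and}\qquad \operatorname{BUC}(G)+B_0(G)=\operatorname{BUC}(G)_1(\tau_{u.c.}).$$ -/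

import Mathlib

open MeasureTheory Filter Topology
open scoped ENNReal Pointwise BoundedContinuousFunction

noncomputable section

namespace LCA

/-! ### The space `L^∞(G)`: locally measurable functions modulo locally null sets -/

section LInf

variable {G : Type*} [MeasurableSpace G]

/-- `E` is locally null: its intersection with every Borel set of finite measure is null. -/
def LocNull (μ : Measure G) (E : Set G) : Prop :=
  ∀ F : Set G, MeasurableSet F → μ F < ∞ → μ (E ∩ F) = 0

/-- The filter of properties that hold locally almost everywhere. -/
def lae (μ : Measure G) : Filter G where
  sets := {s | LocNull μ sᶜ}
  univ_sets := by
    intro F _ _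
    simp
  sets_of_superset := by
    intro s t hs hst F hF hF'
    exact measure_mono_null
      (Set.inter_subset_inter_left F (Set.compl_subset_compl.mpr hst)) (hs F hF hF')
  inter_sets := by
    intro s t hs ht F hF hF'
    have h : (s ∩ t)ᶜ ∩ F = (sᶜ ∩ F) ∪ (tᶜ ∩ F) := by
      rw [Set.compl_inter, Set.union_inter_distrib_right]
    rw [h]
    exact measure_union_null (hs F hF hF') (ht F hF hF')

/-- `f` is locally (Borel) measurable: preimages of Borel sets are Borel inside every Borel set of
finite measure. -/
def LocMeasurable (μ : Measure G) (f : G → ℂ) : Prop :=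
  ∀ A : Set ℂ, MeasurableSet A → ∀ F : Set G, MeasurableSet F → μ F < ∞ →
    MeasurableSet (f ⁻¹' A ∩ F)

theorem locMeasurable_iff {μ : Measure G} {f : G → ℂ} :
    LocMeasurable μ f ↔
      ∀ F : Set G, MeasurableSet F → μ F < ∞ → Measurable (fun x : F => f x) := by
  constructor
  · intro h F hF hF' A hA
    have h1 : (fun x : F => f x) ⁻¹' A = ((↑) : F → G) ⁻¹' (f ⁻¹' A ∩ F) := by
      ext x
      simp
    rw [h1]
    exact measurable_subtype_coe (h A hA F hF hF')
  · intro h A hA F hF hF'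
    have h1 : f ⁻¹' A ∩ F = ((↑) : F → G) '' ((fun x : F => f x) ⁻¹' A) := by
      ext x
      simp [and_comm]
    rw [h1]
    exact hF.subtype_image (h F hF hF' hA)

/-- The functions that are locally measurable and bounded outside a locally null set. -/
def LInfFun (μ : Measure G) : Submodule ℂ (G → ℂ) where
  carrier := {f | LocMeasurable μ f ∧ ∃ C : ℝ, ∀ᶠ x in lae μ, ‖f x‖ ≤ C}
  zero_mem' := by
    refine ⟨locMeasurable_iff.mpr fun F _ _ => measurable_const, 0, ?_⟩
    simp
  add_mem' := by
    rintro f g ⟨hf, C, hC⟩ ⟨hg, D, hD⟩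
    refine ⟨locMeasurable_iff.mpr fun F hF hF' =>
      (locMeasurable_iff.mp hf F hF hF').add (locMeasurable_iff.mp hg F hF hF'), C + D, ?_⟩
    filter_upwards [hC, hD] with x h1 h2
    exact (norm_add_le _ _).trans (add_le_add h1 h2)
  smul_mem' := by
    rintro c f ⟨hf, C, hC⟩
    refine ⟨locMeasurable_iff.mpr fun F hF hF' =>
      (locMeasurable_iff.mp hf F hF hF').const_smul c, ‖c‖ * C, ?_⟩
    filter_upwards [hC] with x h1
    simpa using mul_le_mul_of_nonneg_left h1 (norm_nonneg c)

/-- The functions in `LInfFun μ` that vanish locally almost everywhere. -/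
def LInfNull (μ : Measure G) : Submodule ℂ (LInfFun μ) where
  carrier := {f | ∀ᶠ x in lae μ, (f : G → ℂ) x = 0}
  zero_mem' := by simp
  add_mem' := by
    intro f g hf hg
    change ∀ᶠ x in lae μ, ((f + g : LInfFun μ) : G → ℂ) x = 0
    filter_upwards [hf, hg] with x h1 h2
    simp [h1, h2]
  smul_mem' := by
    intro c f hf
    change ∀ᶠ x in lae μ, ((c • f : LInfFun μ) : G → ℂ) x = 0
    filter_upwards [hf] with x h1
    simp [h1]

/-- `L^∞(G)`. -/
abbrev LInf (μ : Measure G) : Type _ := LInfFun μ ⧸ LInfNull μ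

/-- `‖f χ_S‖_∞`, the local essential supremum of `|f χ_S|`, for an element `f` of `L^∞(G)`. -/
def normOn (μ : Measure G) (S : Set G) (f : LInf μ) : ℝ≥0∞ :=
  Quotient.liftOn' f
    (fun g => limsup (fun x => ‖S.indicator (g : G → ℂ) x‖ₑ) (lae μ))
    (by
      intro g h hgh
      have h0 : g - h ∈ LInfNull μ := (Submodule.quotientRel_def _).mp hgh
      refine limsup_congr ?_
      filter_upwards [h0] with x hx
      have hx' : (g : G → ℂ) x = (h : G → ℂ) x := sub_eq_zero.mp (by simpa using hx)
      by_cases hS : x ∈ S <;> simp [hS, hx'])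

theorem bcf_mem [TopologicalSpace G] [BorelSpace G] (μ : Measure G) (f : G →ᵇ ℂ) : (f : G → ℂ) ∈ LInfFun μ :=
  ⟨fun _ hA _ hF _ => (f.continuous.measurable hA).inter hF, ‖f‖,
    Eventually.of_forall f.norm_coe_le_norm⟩

/-- The topology `τ_{u.c.}` of uniform convergence on compact sets on `L^∞(G)`: it is generated by
the balls of the seminorms `f ↦ ‖f χ_K‖_∞`, `K` compact. -/
@[reducible] def tauUC [TopologicalSpace G] (μ : Measure G) : TopologicalSpace (LInf μ) :=
  TopologicalSpace.generateFrom
    {U | ∃ (K : Set G) (f : LInf μ) (ε : ℝ≥0∞), IsCompact K ∧ U = {g | normOn μ K (g - f) < ε}}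

end LInf

/-! ### Translations on `L^∞(G)` -/

section Translation

variable {G : Type*} [AddCommGroup G] [TopologicalSpace G] [IsTopologicalAddGroup G]
  [MeasurableSpace G] [BorelSpace G]

theorem tendsto_sub_lae (μ : Measure G) [μ.IsAddHaarMeasure] (y : G) :
    Tendsto (fun x => x - y) (lae μ) (lae μ) := by
  intro s hs F hF hF'
  have h1 : MeasurableSet ((fun x => x + y) ⁻¹' F) := (measurable_add_const y) hF
  have h2 : μ ((fun x => x + y) ⁻¹' F) < ∞ := by rwa [measure_preimage_add_right]
  have h3 := hs _ h1 h2
  rw [← measure_preimage_add_right μ (-y)] at h3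
  convert h3 using 2
  ext x
  simp [sub_eq_add_neg]

theorem translate_mem (μ : Measure G) [μ.IsAddHaarMeasure] (y : G) {f : G → ℂ}
    (hf : f ∈ LInfFun μ) : (fun x => f (x - y)) ∈ LInfFun μ := by
  obtain ⟨hm, C, hC⟩ := hf
  refine ⟨?_, C, (tendsto_sub_lae μ y).eventually hC⟩
  intro A hA F hF hF'
  have h1 : MeasurableSet ((fun x => x + y) ⁻¹' F) := (measurable_add_const y) hF
  have h2 : μ ((fun x => x + y) ⁻¹' F) < ∞ := by rwa [measure_preimage_add_right]
  have h3 := (measurable_sub_const y) (hm A hA _ h1 h2)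
  convert h3 using 1
  ext x
  simp

/-- Translation `α_y(f)(x) = f(x - y)` on functions. -/
def translateFun (μ : Measure G) [μ.IsAddHaarMeasure] (y : G) : LInfFun μ →ₗ[ℂ] LInfFun μ where
  toFun f := ⟨fun x => (f : G → ℂ) (x - y), translate_mem μ y f.2⟩
  map_add' _ _ := rfl
  map_smul' _ _ := rfl

/-- Translation `α_y` on `L^∞(G)`. -/
def translate (μ : Measure G) [μ.IsAddHaarMeasure] (y : G) : LInf μ →ₗ[ℂ] LInf μ :=
  (LInfNull μ).mapQ (LInfNull μ) (translateFun μ y)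
    (fun _ hf => (tendsto_sub_lae μ y).eventually hf)

end Translation

/-! ### Bounded uniformly continuous functions and the Samuel compactification -/

section BUC

variable (G : Type*) [AddCommGroup G] [TopologicalSpace G]

/-- `BUC(G)`, as a unital star-subalgebra of the algebra `C_b(G)`. -/
def BUC : StarSubalgebra ℂ (G →ᵇ ℂ) where
  carrier := {f | ∀ ε : ℝ, 0 < ε → ∃ O ∈ 𝓝 (0 : G), ∀ x : G, ∀ y ∈ O, ‖f x - f (x - y)‖ < ε}
  algebraMap_mem' := by
    intro c ε hε
    exact ⟨Set.univ, univ_mem, fun x y _ => by simpa using hε⟩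
  add_mem' := by
    intro f g hf hg ε hε
    obtain ⟨O, hO, h1⟩ := hf (ε / 2) (half_pos hε)
    obtain ⟨P, hP, h2⟩ := hg (ε / 2) (half_pos hε)
    refine ⟨O ∩ P, inter_mem hO hP, fun x y hy => ?_⟩
    have e : (f + g) x - (f + g) (x - y) = (f x - f (x - y)) + (g x - g (x - y)) := by
      simp only [BoundedContinuousFunction.coe_add, Pi.add_apply]
      ring
    rw [e]
    refine (norm_add_le _ _).trans_lt ?_
    linarith [h1 x y hy.1, h2 x y hy.2]
  mul_mem' := by
    intro f g hf hg ε hε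
    have hM : 0 < ‖f‖ + ‖g‖ + 1 := by positivity
    obtain ⟨O, hO, h1⟩ := hf (ε / (‖f‖ + ‖g‖ + 1)) (div_pos hε hM)
    obtain ⟨P, hP, h2⟩ := hg (ε / (‖f‖ + ‖g‖ + 1)) (div_pos hε hM)
    refine ⟨O ∩ P, inter_mem hO hP, fun x y hy => ?_⟩
    have e : (f * g) x - (f * g) (x - y)
        = f x * (g x - g (x - y)) + (f x - f (x - y)) * g (x - y) := by
      simp only [BoundedContinuousFunction.coe_mul, Pi.mul_apply]
      ring
    rw [e]
    refine (norm_add_le _ _).trans_lt ?_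
    rw [norm_mul, norm_mul]
    have a1 := mul_le_mul (f.norm_coe_le_norm x) (h2 x y hy.2).le (norm_nonneg _) (norm_nonneg _)
    have a2 := mul_le_mul (h1 x y hy.1).le (g.norm_coe_le_norm (x - y)) (norm_nonneg _)
      (div_pos hε hM).le
    have a3 : (‖f‖ + ‖g‖ + 1) * (ε / (‖f‖ + ‖g‖ + 1)) = ε := by field_simp
    have a4 := div_pos hε hM
    nlinarith
  star_mem' := by
    intro f hf ε hε
    obtain ⟨O, hO, h1⟩ := hf ε hε
    refine ⟨O, hO, fun x y hy => ?_⟩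
    have e : (star f) x - (star f) (x - y) = star (f x - f (x - y)) := by
      simp
    rw [e, norm_star]
    exact h1 x y hy

/-- The Samuel compactification `σG`: the maximal ideal space (nonzero multiplicative functionals,
with the weak-* topology) of `BUC(G)`. -/
abbrev Samuel : Type _ := WeakDual.characterSpace ℂ (BUC G)

variable {G}

/-- The canonical map `G → σG`, sending `x` to the evaluation at `x`. -/
def delta (x : G) : Samuel G :=
  ⟨StrongDual.toWeakDual
      ((BoundedContinuousFunction.evalCLM ℂ x).comp
        (Subalgebra.toSubmodule (BUC G).toSubalgebra).subtypeL),
    by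
      constructor
      · intro h
        have h1 := DFunLike.congr_fun h (1 : BUC G)
        exact one_ne_zero (α := ℂ) h1
      · intro f g
        rfl⟩

theorem delta_apply (x : G) (f : BUC G) : delta x f = (f : G →ᵇ ℂ) x := rfl

variable (G)

/-- The boundary `∂G = σG ∖ G`. -/
def boundary : Set (Samuel G) := (Set.range (delta : G → Samuel G))ᶜ

end BUC

/-! ### The function spaces inside `L^∞(G)` -/

section Spaces

variable {G : Type*} [AddCommGroup G] [TopologicalSpace G] [IsTopologicalAddGroup G]
  [MeasurableSpace G] [BorelSpace G]

/-- `BUC(G)` as a subset of `L^∞(G)`: the classes with a bounded uniformly continuous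
representative. -/
def BUCClass (μ : Measure G) : Set (LInf μ) :=
  Set.range fun f : BUC G => (LInfNull μ).mkQ ⟨_, bcf_mem μ (f : G →ᵇ ℂ)⟩

/-- `B_0(G)`: the elements of `L^∞(G)` that vanish at infinity. -/
def BZero (μ : Measure G) : Set (LInf μ) :=
  {f | ∀ ε : ℝ≥0∞, 0 < ε → ∃ K : Set G, IsCompact K ∧ normOn μ Kᶜ f < ε}

variable (μ : Measure G) [μ.IsAddHaarMeasure]

/-- `SO(G)`: the slowly oscillating functions. -/
def SO : Set (LInf μ) :=
  {f | ∀ ε : ℝ≥0∞, 0 < ε → ∃ K : Set G, IsCompact K ∧ ∃ O ∈ 𝓝 (0 : G),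
    ∀ y ∈ O, normOn μ Kᶜ (f - translate μ y f) < ε}

/-- `h` is the limit function `α_x(f)` with respect to `τ_{u.c.}`: `α_y(f) → h` as `y ∈ G` tends
to `x` in `σG`. The filter `comap delta (𝓝 x)` on `G` is the coarsest one along which `delta`
tends to `x`, so this is convergence of `α_{x_γ}(f)` for every net `x_γ → x` in `G`. -/
def IsLimitFunction (f : LInf μ) (x : Samuel G) (h : LInf μ) : Prop :=
  Tendsto (fun y : G => translate μ y f) (comap delta (𝓝 x)) (@nhds _ (tauUC μ) h)

/-- Uniform equicontinuity of a family in `L^∞(G)`. -/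
def UnifEquicont (F : Set (LInf μ)) : Prop :=
  ∀ ε : ℝ≥0∞, 0 < ε → ∃ O ∈ 𝓝 (0 : G), ∀ y ∈ O, ∀ f ∈ F,
    normOn μ Set.univ (translate μ y f - f) < ε

/-- `BUC(G)_1(τ_{u.c.})`: all limit functions of `f` on `∂G` exist with respect to `τ_{u.c.}`, lie
in `BUC(G)`, and form a uniformly equicontinuous family. -/
def BUCOne : Set (LInf μ) :=
  {f | (∀ x ∈ boundary G, ∃ h, IsLimitFunction μ f x h) ∧
    (∀ x ∈ boundary G, ∀ h, IsLimitFunction μ f x h → h ∈ BUCClass μ) ∧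
    UnifEquicont μ {h | ∃ x ∈ boundary G, IsLimitFunction μ f x h}}

end Spaces

end LCA

end

/-! The cycle of inclusions is BUC + B_0 ⊆ SO ⊆ BUC + B_0 ⊆ BUC_1 ⊆ SO.

The substance of `SO_subset_add` is smoothing and patching. If `f` oscillates by at most `ε` outside
a compact set under translations from `O`, then convolving `f` with a unit-mass bump supported in
`O` yields a function in BUC that is uniformly close to `f` outside that compact set
(`exists_mem_BUC_approx`). Doing this for `ε = 2⁻ⁿ` gives functions `g n`, and the corrections `g
(n+1) - g n`, cut off to vanish where they are not known to be small, sum uniformly to some `H` in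
BUC with `f - H` in B_0.

For `add_subset_BUCOne`, the limit function of `f` in BUC at a character `x` is `z ↦ x (w ↦ f (z -
w))`; it inherits every modulus of continuity of `f`, which gives equicontinuity uniformly in `x`.
Elements of B_0 are pushed off each compact set and have limit zero. Density of `G` in `σG` makes
limits unique.

`BUCOne_subset_SO` is a compactness argument: were `f` to oscillate at points escaping every compact
set, an ultrafilter of such points would converge in `σG` to a boundary point, where the limit
function would oscillate too, against equicontinuity.

Since `G` need not be σ-compact and `μ` need not be σ-finite, local null sets are tested on compact
sets, and Fubini is applied on products of compact sets. -/

noncomputable section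

namespace LCA

/-! ### Local essential suprema and the topology of uniform convergence on compact sets -/

section SeminormAPI

variable {G : Type*} [MeasurableSpace G] {μ : Measure G}

theorem mem_lae_iff {s : Set G} : s ∈ lae μ ↔ LocNull μ sᶜ := Iff.rfl

/-- Closure under countable intersections is what makes the local essential supremum an essential
bound itself, as used in `normOn_cls_le_iff`. -/
instance : CountableInterFilter (lae μ) where
  countable_sInter_mem S hS h := by
    rw [mem_lae_iff]
    intro F hF hF'
    have e : (⋂₀ S)ᶜ ∩ F = ⋃ s ∈ S, sᶜ ∩ F := by
      ext x
      simp only [Set.mem_inter_iff, Set.mem_compl_iff, Set.mem_sInter, Set.mem_iUnion]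
      push Not
      constructor
      · rintro ⟨⟨s, h1, h2⟩, h3⟩
        exact ⟨s, h1, h2, h3⟩
      · rintro ⟨s, h1, h2, h3⟩
        exact ⟨⟨s, h1, h2⟩, h3⟩
    rw [e, measure_biUnion_null_iff hS]
    exact fun s hs => h s hs F hF hF'

/-- The class in `L^∞(G)` of a function. -/
abbrev cls (μ : Measure G) : LInfFun μ →ₗ[ℂ] LInf μ := (LInfNull μ).mkQ

theorem cls_surjective : Function.Surjective (cls μ) := Submodule.mkQ_surjective _

theorem cls_eq_iff {f g : LInfFun μ} :
    cls μ f = cls μ g ↔ ∀ᶠ x in lae μ, (f : G → ℂ) x = (g : G → ℂ) x := by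
  rw [← sub_eq_zero, ← map_sub, Submodule.mkQ_apply, Submodule.Quotient.mk_eq_zero]
  change (∀ᶠ x in lae μ, ((f - g : LInfFun μ) : G → ℂ) x = 0) ↔ _
  simp [sub_eq_zero]

theorem normOn_cls_le_iff {S : Set G} {f : LInfFun μ} {c : ℝ≥0∞} :
    normOn μ S (cls μ f) ≤ c ↔ ∀ᶠ x in lae μ, x ∈ S → ‖(f : G → ℂ) x‖ₑ ≤ c := by
  change limsup (fun x => ‖S.indicator (f : G → ℂ) x‖ₑ) (lae μ) ≤ c ↔ _
  have key : ∀ x, ‖S.indicator (f : G → ℂ) x‖ₑ ≤ c ↔ (x ∈ S → ‖(f : G → ℂ) x‖ₑ ≤ c) := by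
    intro x
    by_cases hx : x ∈ S <;> simp [hx]
  constructor
  · intro h
    filter_upwards [eventually_le_limsup (f := lae μ)
      (u := fun x => ‖S.indicator (f : G → ℂ) x‖ₑ)] with x hx
    exact (key x).1 (hx.trans h)
  · intro h
    exact limsup_le_of_le (by isBoundedDefault) (h.mono fun x hx => (key x).2 hx)

theorem eventually_le_normOn (S : Set G) (f : LInfFun μ) :
    ∀ᶠ x in lae μ, x ∈ S → ‖(f : G → ℂ) x‖ₑ ≤ normOn μ S (cls μ f) :=
  normOn_cls_le_iff.1 le_rfl

theorem normOn_mono {S T : Set G} (h : S ⊆ T) (f : LInf μ) : normOn μ S f ≤ normOn μ T f := by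
  obtain ⟨f, rfl⟩ := cls_surjective f
  exact normOn_cls_le_iff.2 ((eventually_le_normOn T f).mono fun x hx hxS => hx (h hxS))

theorem normOn_add_le (S : Set G) (f g : LInf μ) :
    normOn μ S (f + g) ≤ normOn μ S f + normOn μ S g := by
  obtain ⟨f, rfl⟩ := cls_surjective f
  obtain ⟨g, rfl⟩ := cls_surjective g
  rw [← map_add, normOn_cls_le_iff]
  filter_upwards [eventually_le_normOn S f, eventually_le_normOn S g] with x h1 h2 hx
  exact (enorm_add_le _ _).trans (add_le_add (h1 hx) (h2 hx))

theorem normOn_neg (S : Set G) (f : LInf μ) : normOn μ S (-f) = normOn μ S f := by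
  have key : ∀ f : LInf μ, normOn μ S (-f) ≤ normOn μ S f := by
    intro f
    obtain ⟨f, rfl⟩ := cls_surjective f
    rw [← map_neg, normOn_cls_le_iff]
    filter_upwards [eventually_le_normOn S f] with x h1 hx
    simpa using h1 hx
  exact le_antisymm (key f) (by simpa using key (-f))

theorem normOn_zero (S : Set G) : normOn μ S (0 : LInf μ) = 0 := by
  rw [← map_zero (cls μ), ← nonpos_iff_eq_zero, normOn_cls_le_iff]
  exact Eventually.of_forall fun x _ => by simp

theorem normOn_sub_rev (S : Set G) (f g : LInf μ) :
    normOn μ S (f - g) = normOn μ S (g - f) := by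
  rw [← normOn_neg, neg_sub]

theorem normOn_sub_le (S : Set G) (f g h : LInf μ) :
    normOn μ S (f - h) ≤ normOn μ S (f - g) + normOn μ S (g - h) := by
  rw [← sub_add_sub_cancel f g h]
  exact normOn_add_le _ _ _

/-- The generating balls have arbitrary centres; by the triangle inequality each one containing `h`
contains a ball for the same `K` centred at `h`. -/
theorem tendsto_tauUC_iff [TopologicalSpace G] {ι : Type*} {l : Filter ι} {F : ι → LInf μ}
    {h : LInf μ} :
    Tendsto F l (@nhds _ (tauUC μ) h) ↔
      ∀ K : Set G, IsCompact K → ∀ ε : ℝ≥0∞, 0 < ε → ∀ᶠ i in l, normOn μ K (F i - h) < ε := by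
  rw [TopologicalSpace.tendsto_nhds_generateFrom_iff]
  constructor
  · intro H K hK ε hε
    exact H _ ⟨K, h, ε, hK, rfl⟩ (by simpa [normOn_zero] using hε)
  · rintro H _ ⟨K, f, ε, hK, rfl⟩ hh
    filter_upwards [H K hK (ε - normOn μ K (h - f)) (tsub_pos_of_lt hh)] with i hi
    exact (normOn_sub_le K (F i) h f).trans_lt (lt_tsub_iff_right.1 hi)

theorem measurableSet_inter_of_locMeasurable {f : G → ℂ} (hf : LocMeasurable μ f) {A : Set ℂ}
    (hA : MeasurableSet A) {S : Set G} (hS : MeasurableSet S) {F : Set G} (hF : MeasurableSet F)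
    (hF' : μ F < ∞) : MeasurableSet ((S ∩ f ⁻¹' A) ∩ F) := by
  rw [Set.inter_assoc]
  exact hS.inter (hf A hA F hF hF')

/-- Inner regularity applies to the traces of `E` on sets of finite measure; `E` itself need not be
Borel. -/
theorem locNull_of_forall_isCompact [TopologicalSpace G] [μ.InnerRegularCompactLTTop] {E : Set G}
    (hE : ∀ F : Set G, MeasurableSet F → μ F < ∞ → MeasurableSet (E ∩ F))
    (h : ∀ C : Set G, IsCompact C → C ⊆ E → μ C = 0) : LocNull μ E := by
  intro F hF hF'
  by_contra h0
  obtain ⟨C, hC, hCc, hC0⟩ := (hE F hF hF').exists_lt_isCompact_of_ne_top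
    ((measure_mono Set.inter_subset_right).trans_lt hF').ne (pos_iff_ne_zero.2 h0)
  exact hC0.ne' (h C hCc (hC.trans Set.inter_subset_left))

theorem LocNull.measure_eq_zero_of_isCompact [TopologicalSpace G] [T2Space G] [BorelSpace G]
    [IsFiniteMeasureOnCompacts μ] {E C : Set G} (hE : LocNull μ E) (hC : IsCompact C)
    (h : C ⊆ E) : μ C = 0 := by
  have := hE C hC.isClosed.measurableSet hC.measure_lt_top
  rwa [Set.inter_eq_self_of_subset_right h] at this

/-- The local essential supremum can be computed locally. -/
theorem normOn_le_of_forall_nhds [TopologicalSpace G] [T2Space G] [BorelSpace G]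
    [IsFiniteMeasureOnCompacts μ] [μ.InnerRegularCompactLTTop] {S : Set G} (hS : MeasurableSet S)
    {f : LInf μ} {c : ℝ≥0∞} (h : ∀ x ∈ S, ∃ W ∈ 𝓝 x, normOn μ W f ≤ c) : normOn μ S f ≤ c := by
  obtain ⟨f, rfl⟩ := cls_surjective f
  rw [normOn_cls_le_iff]
  have e : {x | x ∈ S → ‖(f : G → ℂ) x‖ₑ ≤ c}ᶜ = S ∩ (f : G → ℂ) ⁻¹' {z | c < ‖z‖ₑ} := by
    ext x
    simp
  change LocNull μ _
  rw [e]
  refine locNull_of_forall_isCompact (fun F hF hF' => measurableSet_inter_of_locMeasurable f.2.1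
    (measurableSet_lt measurable_const measurable_enorm) hS hF hF') fun C hC hCE => ?_
  -- Compactness of `C` reduces the uncountable family of neighborhoods to a finite one.
  refine hC.measure_zero_of_nhdsWithin fun x hx => ?_
  obtain ⟨W, hW, hWc⟩ := h x (hCE hx).1
  refine ⟨C ∩ W, inter_mem_nhdsWithin _ hW, ?_⟩
  have h1 : LocNull μ _ := normOn_cls_le_iff.1 hWc
  refine measure_mono_null ?_ (h1 C hC.isClosed.measurableSet hC.measure_lt_top)
  rintro y ⟨hyC, hyW⟩
  refine ⟨fun hy => ?_, hyC⟩
  exact not_le.2 (hCE hyC).2 (hy hyW)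

theorem eq_of_forall_normOn_isCompact [TopologicalSpace G] [T2Space G] [BorelSpace G]
    [LocallyCompactSpace G] [IsFiniteMeasureOnCompacts μ] [μ.InnerRegularCompactLTTop]
    {f g : LInf μ} (h : ∀ K : Set G, IsCompact K → normOn μ K (f - g) = 0) : f = g := by
  have h1 : normOn μ Set.univ (f - g) ≤ 0 :=
    normOn_le_of_forall_nhds MeasurableSet.univ fun x _ => by
      obtain ⟨W, hW, hWx⟩ := exists_compact_mem_nhds x
      exact ⟨W, hWx, (h W hW).le⟩
  obtain ⟨f, rfl⟩ := cls_surjective f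
  obtain ⟨g, rfl⟩ := cls_surjective g
  rw [← map_sub, normOn_cls_le_iff] at h1
  rw [cls_eq_iff]
  filter_upwards [h1] with x hx
  simpa [sub_eq_zero] using hx

/-- A continuous function is bounded everywhere on an open set by its essential bound. -/
theorem le_of_eventually_lae [TopologicalSpace G] [T2Space G] [BorelSpace G]
    [LocallyCompactSpace G] [IsFiniteMeasureOnCompacts μ] [μ.IsOpenPosMeasure] {u : G → ℝ}
    (hu : Continuous u) {S : Set G} (hS : IsOpen S) {c : ℝ}
    (h : ∀ᶠ x in lae μ, x ∈ S → u x ≤ c) : ∀ x ∈ S, u x ≤ c := by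
  intro x hx
  by_contra! hc
  have h1 : LocNull μ _ := h
  have hV : S ∩ {y | c < u y} ∈ 𝓝 x :=
    (hS.inter (isOpen_lt continuous_const hu)).mem_nhds ⟨hx, hc⟩
  obtain ⟨C, hCx, hCV, hC⟩ := local_compact_nhds hV
  refine (Measure.measure_pos_of_mem_nhds μ hCx).ne'
    (h1.measure_eq_zero_of_isCompact hC fun y hy => ?_)
  intro h2
  exact not_lt.2 (h2 (hCV hy).1) (hCV hy).2

end SeminormAPI

/-! ### Translations -/

section TranslationAPI

variable {G : Type*} [AddCommGroup G] [TopologicalSpace G] [IsTopologicalAddGroup G]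
  [MeasurableSpace G] [BorelSpace G] {μ : Measure G} [μ.IsAddHaarMeasure]

theorem translate_cls (y : G) (f : LInfFun μ) :
    translate μ y (cls μ f) = cls μ (translateFun μ y f) := rfl

theorem translateFun_apply (y : G) (f : LInfFun μ) (x : G) :
    (translateFun μ y f : G → ℂ) x = (f : G → ℂ) (x - y) := rfl

theorem translate_translate (y z : G) (f : LInf μ) :
    translate μ y (translate μ z f) = translate μ (y + z) f := by
  obtain ⟨f, rfl⟩ := cls_surjective f
  simp only [translate_cls]
  congr 1
  ext x
  simp only [translateFun_apply, sub_sub]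

theorem translate_zero (f : LInf μ) : translate μ 0 f = f := by
  obtain ⟨f, rfl⟩ := cls_surjective f
  rw [translate_cls]
  congr 1
  ext x
  simp only [translateFun_apply, sub_zero]

theorem normOn_translate_le (S : Set G) (y : G) (f : LInf μ) :
    normOn μ S (translate μ y f) ≤ normOn μ ((fun x => x + y) ⁻¹' S) f := by
  obtain ⟨f, rfl⟩ := cls_surjective f
  rw [translate_cls, normOn_cls_le_iff]
  filter_upwards [(tendsto_sub_lae μ y).eventually
    (eventually_le_normOn ((fun x => x + y) ⁻¹' S) f)] with x hx hxS
  rw [translateFun_apply]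
  exact hx (by simpa using hxS)

theorem normOn_translate (S : Set G) (y : G) (f : LInf μ) :
    normOn μ S (translate μ y f) = normOn μ ((fun x => x + y) ⁻¹' S) f := by
  refine le_antisymm (normOn_translate_le S y f) ?_
  have h := normOn_translate_le ((fun x => x + y) ⁻¹' S) (-y) (translate μ y f)
  rw [translate_translate, neg_add_cancel, translate_zero] at h
  refine h.trans (normOn_mono ?_ _)
  intro x hx
  simpa using hx

end TranslationAPI

/-! ### The algebra BUC and density of `G` in its maximal ideal space -/

section BUCAPI

variable {G : Type*} [AddCommGroup G] [TopologicalSpace G]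

theorem mem_BUC_iff {f : G →ᵇ ℂ} :
    f ∈ BUC G ↔ ∀ ε : ℝ, 0 < ε → ∃ O ∈ 𝓝 (0 : G), ∀ x : G, ∀ y ∈ O, ‖f x - f (x - y)‖ < ε :=
  Iff.rfl

theorem isClosed_BUC : IsClosed (BUC G : Set (G →ᵇ ℂ)) := by
  refine isClosed_of_closure_subset fun f hf ε hε => ?_
  obtain ⟨g, hg, hfg⟩ := Metric.mem_closure_iff.1 hf (ε / 3) (by positivity)
  obtain ⟨O, hO, h⟩ := mem_BUC_iff.1 hg (ε / 3) (by positivity)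
  refine ⟨O, hO, fun x y hy => ?_⟩
  have h1 := (BoundedContinuousFunction.dist_coe_le_dist (f := f) (g := g) x).trans_lt hfg
  have h2 := (BoundedContinuousFunction.dist_coe_le_dist (f := f) (g := g) (x - y)).trans_lt hfg
  rw [dist_eq_norm] at h1 h2
  have e : f x - f (x - y) = (f x - g x) + (g x - g (x - y)) - (f (x - y) - g (x - y)) := by ring
  rw [e]
  refine (norm_sub_le _ _).trans_lt ?_
  have := norm_add_le (f x - g x) (g x - g (x - y))
  linarith [h x y hy]

instance : CompleteSpace (BUC G) := isClosed_BUC.completeSpace_coe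

instance : CompactSpace (Samuel G) :=
  inferInstanceAs (CompactSpace (WeakDual.characterSpace ℂ (BUC G)))

theorem continuous_delta : Continuous (delta : G → Samuel G) := by
  refine Continuous.subtype_mk (WeakDual.continuous_of_continuous_eval fun f => ?_) _
  exact (f : G →ᵇ ℂ).continuous

theorem continuous_eval_samuel (f : BUC G) : Continuous fun x : Samuel G => x f :=
  (WeakDual.eval_continuous f).comp continuous_subtype_val

/-- A function in `BUC(G)` that is bounded away from zero is invertible. -/
theorem exists_mul_eq_one {g : BUC G} {ε : ℝ} (hε : 0 < ε)
    (h : ∀ x, ε ≤ ‖(g : G →ᵇ ℂ) x‖) : ∃ k : BUC G, g * k = 1 := by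
  have hne : ∀ x, (g : G →ᵇ ℂ) x ≠ 0 := fun x => norm_pos_iff.1 (hε.trans_le (h x))
  let k : G →ᵇ ℂ := BoundedContinuousFunction.ofNormedAddCommGroup
    (fun x => ((g : G →ᵇ ℂ) x)⁻¹) ((g : G →ᵇ ℂ).continuous.inv₀ hne) ε⁻¹ fun x => by
      rw [norm_inv]
      exact inv_anti₀ hε (h x)
  have hk : k ∈ BUC G := by
    rw [mem_BUC_iff]
    intro η hη
    obtain ⟨O, hO, hO'⟩ := mem_BUC_iff.1 g.2 (η * ε * ε) (by positivity)
    refine ⟨O, hO, fun x y hy => ?_⟩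
    change ‖((g : G →ᵇ ℂ) x)⁻¹ - ((g : G →ᵇ ℂ) (x - y))⁻¹‖ < η
    rw [inv_sub_inv (hne _) (hne _), norm_div, norm_mul, norm_sub_rev,
      div_lt_iff₀ (mul_pos (norm_pos_iff.2 (hne _)) (norm_pos_iff.2 (hne _)))]
    refine (hO' x y hy).trans_le ?_
    rw [mul_assoc]
    have := mul_le_mul (h x) (h (x - y)) hε.le (norm_nonneg _)
    gcongr
  refine ⟨⟨k, hk⟩, ?_⟩
  ext x
  change (g : G →ᵇ ℂ) x * ((g : G →ᵇ ℂ) x)⁻¹ = 1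
  exact mul_inv_cancel₀ (hne x)

theorem isInducing_eval_samuel :
    IsInducing (fun (x : Samuel G) (f : BUC G) => x f) :=
  IsInducing.comp (g := fun (x : WeakDual ℂ (BUC G)) (f : BUC G) => x f) ⟨rfl⟩
    IsInducing.subtypeVal

/-- If evaluations miss a basic neighborhood of `x`, a sum of squared moduli of functions killed by
`x` is at least 1 on `G`, hence invertible in BUC, although `x` sends it to zero. -/
theorem denseRange_delta : DenseRange (delta : G → Samuel G) := by
  intro x
  rw [mem_closure_iff_nhds]
  intro U hU
  rw [isInducing_eval_samuel.nhds_eq_comap, mem_comap] at hU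
  obtain ⟨t, ht, htU⟩ := hU
  rw [nhds_pi, Filter.mem_pi'] at ht
  obtain ⟨I, s, hs, hst⟩ := ht
  have hs' : ∀ f : BUC G, ∃ ε : ℝ, 0 < ε ∧ Metric.ball (x f) ε ⊆ s f :=
    fun f => Metric.mem_nhds_iff.1 (hs f)
  choose ε hε hεs using hs'
  by_contra hemp
  have hfar : ∀ y : G, ∃ f ∈ I, ε f ≤ ‖(f : G →ᵇ ℂ) y - x f‖ := by
    intro y
    by_contra! hy
    refine hemp ⟨delta y, htU (hst fun f hf => hεs f ?_), y, rfl⟩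
    rw [Metric.mem_ball, dist_eq_norm]
    exact hy f hf
  -- Normalized so that `x (h f) = 0` and, at each point of `G`, some `h f` with `f ∈ I` has modulus
  -- at least 1.
  let h : BUC G → BUC G := fun f => ((ε f)⁻¹ : ℂ) • (f - algebraMap ℂ (BUC G) (x f))
  have hx : ∀ f, x (h f) = 0 := fun f => by
    have : x (algebraMap ℂ (BUC G) (x f)) = x f := AlgHomClass.commutes x (x f)
    simp only [h, map_smul, map_sub, this, sub_self, smul_zero]
  let g : BUC G := ∑ f ∈ I, star (h f) * h f
  have hgx : x g = 0 := by
    simp only [g, map_sum, map_mul, hx, mul_zero, Finset.sum_const_zero]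
  have hgy : ∀ y : G, (g : G →ᵇ ℂ) y =
      ((∑ f ∈ I, ‖(h f : G →ᵇ ℂ) y‖ ^ 2 : ℝ) : ℂ) := by
    intro y
    have h1 : delta y g = ∑ f ∈ I, delta y (star (h f)) * delta y (h f) := by
      simp only [g, map_sum, map_mul]
    rw [← delta_apply, h1]
    push_cast
    refine Finset.sum_congr rfl fun f _ => ?_
    exact Complex.conj_mul' _
  have hg1 : ∀ y : G, 1 ≤ ‖(g : G →ᵇ ℂ) y‖ := by
    intro y
    obtain ⟨f, hfI, hf⟩ := hfar y
    rw [hgy, Complex.norm_real, Real.norm_eq_abs]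
    refine le_trans ?_ (le_abs_self _)
    refine le_trans ?_ (Finset.single_le_sum (f := fun f => ‖(h f : G →ᵇ ℂ) y‖ ^ 2)
      (fun f _ => by positivity) hfI)
    have h2 : (h f : G →ᵇ ℂ) y = ((ε f)⁻¹ : ℂ) * ((f : G →ᵇ ℂ) y - x f) := rfl
    have h3 : 1 ≤ ‖(h f : G →ᵇ ℂ) y‖ := by
      rw [h2, norm_mul, norm_inv, Complex.norm_real, Real.norm_eq_abs, abs_of_pos (hε f),
        ← div_eq_inv_mul, one_le_div (hε f)]
      exact hf
    exact one_le_pow₀ h3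
  obtain ⟨k, hk⟩ := exists_mul_eq_one one_pos hg1
  have h4 := congrArg x hk
  rw [map_mul, hgx, zero_mul, map_one] at h4
  exact zero_ne_one h4

end BUCAPI

section BUCGroup

variable {G : Type*} [AddCommGroup G] [TopologicalSpace G] [IsTopologicalAddGroup G]

theorem exists_nhds_of_hasCompactSupport {E : Type*} [NormedAddCommGroup E] {f : G → E}
    (hf : Continuous f) (hc : HasCompactSupport f) {ε : ℝ} (hε : 0 < ε) :
    ∃ O ∈ 𝓝 (0 : G), ∀ x : G, ∀ y ∈ O, ‖f x - f (x - y)‖ < ε := by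
  let := IsTopologicalAddGroup.rightUniformSpace G
  have := isUniformAddGroup_of_addCommGroup (G := G)
  have h := hc.uniformContinuous_of_continuous hf
  have h1 := h (Metric.dist_mem_uniformity hε)
  rw [uniformity_eq_comap_nhds_zero, Filter.mem_map, mem_comap] at h1
  obtain ⟨O, hO, h1⟩ := h1
  refine ⟨O, hO, fun x y hy => ?_⟩
  have h2 := @h1 (x - y, x) (by simpa using hy)
  simpa [dist_eq_norm, norm_sub_rev] using h2

end BUCGroup

theorem exists_ofReal_lt {ε : ℝ≥0∞} (hε : 0 < ε) : ∃ δ : ℝ, 0 < δ ∧ ENNReal.ofReal δ < ε := by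
  obtain ⟨r, hr, hr'⟩ := ENNReal.lt_iff_exists_nnreal_btwn.1 hε
  exact ⟨r, by exact_mod_cast hr, by simpa using hr'⟩

/-! ### Limit functions of elements of BUC -/

section LimitOfBUC

variable {G : Type*} [AddCommGroup G] [TopologicalSpace G] [IsTopologicalAddGroup G]

theorem exists_mem_BUC {u : G → ℂ} {C : ℝ} (hC : ∀ x, ‖u x‖ ≤ C)
    (hu : ∀ ε : ℝ, 0 < ε → ∃ O ∈ 𝓝 (0 : G), ∀ x : G, ∀ y ∈ O, ‖u x - u (x - y)‖ < ε) :
    ∃ k ∈ BUC G, ∀ x, k x = u x := by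
  have hcont : Continuous u := by
    rw [continuous_iff_continuousAt]
    intro x
    rw [ContinuousAt, Metric.tendsto_nhds]
    intro ε hε
    obtain ⟨O, hO, h⟩ := hu ε hε
    have h1 : Tendsto (fun z => x - z) (𝓝 x) (𝓝 0) := by
      have : Continuous fun z => x - z := by fun_prop
      simpa using this.tendsto x
    filter_upwards [h1 hO] with z hz
    have := h x (x - z) hz
    rw [sub_sub_cancel] at this
    rwa [dist_comm, dist_eq_norm]
  exact ⟨BoundedContinuousFunction.ofNormedAddCommGroup u hcont C hC, hu, fun x => rfl⟩

/-- The function `y ↦ f (z - y)`. -/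
def reflect (f : BUC G) (z : G) : BUC G :=
  ⟨(f : G →ᵇ ℂ).compContinuous ⟨fun y => z - y, by fun_prop⟩, by
    intro ε hε
    obtain ⟨O, hO, h⟩ := mem_BUC_iff.1 f.2 ε hε
    refine ⟨-O, neg_mem_nhds_zero G hO, fun x y hy => ?_⟩
    have := h (z - x) (-y) hy
    have e : z - x - -y = z - (x - y) := by abel
    rwa [e] at this⟩

omit [IsTopologicalAddGroup G] in
theorem norm_apply_le_of_forall (x : Samuel G) {k : BUC G} {c : ℝ}
    (h : ∀ y, ‖(k : G →ᵇ ℂ) y‖ ≤ c) : ‖x k‖ ≤ c :=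
  denseRange_delta.induction_on (p := fun x : Samuel G => ‖x k‖ ≤ c) x
    (isClosed_le (continuous_eval_samuel k).norm continuous_const) h

/-- The pointwise limits of the translates of a function in `BUC(G)`. -/
theorem exists_pointwise_limit (f : BUC G) (x : Samuel G) :
    ∃ h ∈ BUC G, (∀ z, h z = x (reflect f z)) ∧
      ∀ (c : ℝ) (O : Set G), (∀ z, ∀ y ∈ O, ‖(f : G →ᵇ ℂ) z - (f : G →ᵇ ℂ) (z - y)‖ ≤ c) →
        ∀ z, ∀ y ∈ O, ‖h z - h (z - y)‖ ≤ c := by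
  -- A bound valid on `G` passes to every character by density, so a modulus of continuity of `f`
  -- carries over to the limit independently of `x`.
  have hmod : ∀ (c : ℝ) (O : Set G),
      (∀ z, ∀ y ∈ O, ‖(f : G →ᵇ ℂ) z - (f : G →ᵇ ℂ) (z - y)‖ ≤ c) →
      ∀ z, ∀ y ∈ O, ‖x (reflect f z) - x (reflect f (z - y))‖ ≤ c := by
    intro c O hO z y hy
    rw [← map_sub]
    refine norm_apply_le_of_forall x fun w => ?_
    have := hO (z - w) y hy
    change ‖(f : G →ᵇ ℂ) (z - w) - (f : G →ᵇ ℂ) (z - y - w)‖ ≤ c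
    rwa [sub_right_comm z y w]
  obtain ⟨h, hh, hx⟩ := exists_mem_BUC (u := fun z => x (reflect f z)) (C := ‖(f : G →ᵇ ℂ)‖)
    (fun z => norm_apply_le_of_forall x fun y => (f : G →ᵇ ℂ).norm_coe_le_norm _) (by
      intro ε hε
      obtain ⟨O, hO, h⟩ := mem_BUC_iff.1 f.2 (ε / 2) (half_pos hε)
      exact ⟨O, hO, fun z y hy =>
        (hmod (ε / 2) O (fun z y hy => (h z y hy).le) z y hy).trans_lt (half_lt_self hε)⟩)
  refine ⟨h, hh, hx, ?_⟩
  intro c O hO z y hy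
  rw [hx, hx]
  exact hmod c O hO z y hy

/-- Convergence at each single point is the weak-* topology; the translates of `f` are
equicontinuous, so convergence on a finite net of `K` gives it uniformly on `K`. -/
theorem eventually_norm_sub_lt (f : BUC G) (x : Samuel G) {h : G →ᵇ ℂ} (hh : h ∈ BUC G)
    (hx : ∀ z, h z = x (reflect f z)) {K : Set G} (hK : IsCompact K) {ε : ℝ} (hε : 0 < ε) :
    ∀ᶠ y in comap delta (𝓝 x), ∀ z ∈ K, ‖(f : G →ᵇ ℂ) (z - y) - h z‖ ≤ ε := by
  obtain ⟨O, hO, hfO⟩ := mem_BUC_iff.1 f.2 (ε / 3) (by positivity)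
  obtain ⟨P, hP, hhP⟩ := mem_BUC_iff.1 hh (ε / 3) (by positivity)
  obtain ⟨t, -, hKt⟩ := hK.elim_nhds_subcover (fun w => {z | w - z ∈ O ∩ P}) (by
    intro w _
    have : Continuous fun z => w - z := by fun_prop
    exact this.continuousAt.preimage_mem_nhds (by simpa using ⟨hO, hP⟩))
  have hev : ∀ᶠ y in comap delta (𝓝 x), ∀ w ∈ t, ‖(f : G →ᵇ ℂ) (w - y) - h w‖ < ε / 3 := by
    rw [Filter.eventually_all_finset]
    intro w _
    have h1 := (continuous_eval_samuel (reflect f w)).continuousAt (x := x)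
    have h2 := (Metric.tendsto_nhds.1 h1.tendsto (ε / 3) (by positivity)).comap (delta : G → _)
    filter_upwards [h2] with y hy
    rwa [hx, ← dist_eq_norm]
  filter_upwards [hev] with y hy z hz
  obtain ⟨w, hw, hzw⟩ := Set.mem_iUnion₂.1 (hKt hz)
  have h1 := hfO (w - y) (w - z) hzw.1
  have h2 := hhP w (w - z) hzw.2
  have h3 := hy w hw
  rw [sub_sub_cancel] at h2
  rw [show w - y - (w - z) = z - y by abel] at h1
  have e : (f : G →ᵇ ℂ) (z - y) - h z = ((f : G →ᵇ ℂ) (w - y) - h w) -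
      ((f : G →ᵇ ℂ) (w - y) - (f : G →ᵇ ℂ) (z - y)) + (h w - h z) := by ring
  rw [e]
  refine (norm_add_le _ _).trans ?_
  have := norm_sub_le ((f : G →ᵇ ℂ) (w - y) - h w)
      ((f : G →ᵇ ℂ) (w - y) - (f : G →ᵇ ℂ) (z - y))
  linarith

omit [IsTopologicalAddGroup G] in
-- The image of a compact set is closed in `σG` and misses every boundary point.
theorem comap_delta_le_cocompact {x : Samuel G} (hx : x ∈ boundary G) :
    comap delta (𝓝 x) ≤ cocompact G := by
  intro s hs
  obtain ⟨K, hK, hKs⟩ := mem_cocompact.1 hs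
  have h1 : IsClosed (delta '' K) := (hK.image continuous_delta).isClosed
  refine mem_comap.2 ⟨(delta '' K)ᶜ, h1.isOpen_compl.mem_nhds ?_, fun y hy => hKs fun hyK => ?_⟩
  · rintro ⟨y, -, rfl⟩
    exact hx ⟨y, rfl⟩
  · exact hy ⟨y, hyK, rfl⟩

omit [IsTopologicalAddGroup G] in
instance neBot_comap_delta (x : Samuel G) : (comap (delta : G → Samuel G) (𝓝 x)).NeBot :=
  comap_neBot fun t ht => by
    obtain ⟨_, h, y, rfl⟩ := mem_closure_iff_nhds.1 (denseRange_delta x) t ht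
    exact ⟨y, h⟩

end LimitOfBUC

/-! ### The inclusions of BUC + B_0 in SO and in BUC_1 -/

section Inclusions

variable {G : Type*} [AddCommGroup G] [TopologicalSpace G] [IsTopologicalAddGroup G]
  [MeasurableSpace G] [BorelSpace G] {μ : Measure G}

/-- The class in `L^∞(G)` of a bounded continuous function. -/
def bcfCls (μ : Measure G) (f : G →ᵇ ℂ) : LInf μ := cls μ ⟨f, bcf_mem μ f⟩

omit [IsTopologicalAddGroup G] in
theorem mem_BUCClass_iff {f : LInf μ} : f ∈ BUCClass μ ↔ ∃ g ∈ BUC G, bcfCls μ g = f := by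
  constructor
  · rintro ⟨g, rfl⟩
    exact ⟨g, g.2, rfl⟩
  · rintro ⟨g, hg, rfl⟩
    exact ⟨⟨g, hg⟩, rfl⟩

variable [μ.IsAddHaarMeasure]

theorem normOn_translate_sub_bcfCls_le {S : Set G} {y : G} {f g : G →ᵇ ℂ} {c : ℝ}
    (h : ∀ x ∈ S, ‖f (x - y) - g x‖ ≤ c) :
    normOn μ S (translate μ y (bcfCls μ f) - bcfCls μ g) ≤ ENNReal.ofReal c := by
  rw [bcfCls, bcfCls, translate_cls, ← map_sub, normOn_cls_le_iff]
  refine Eventually.of_forall fun x hx => ?_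
  rw [← ofReal_norm]
  exact ENNReal.ofReal_le_ofReal (h x hx)

theorem BUCClass_subset_SO : BUCClass μ ⊆ SO μ := by
  intro f hf ε hε
  obtain ⟨g, hg, rfl⟩ := mem_BUCClass_iff.1 hf
  obtain ⟨δ, hδ, hδε⟩ := exists_ofReal_lt hε
  obtain ⟨O, hO, h⟩ := mem_BUC_iff.1 hg δ hδ
  refine ⟨∅, isCompact_empty, O, hO, fun y hy => ?_⟩
  rw [normOn_sub_rev]
  refine (normOn_translate_sub_bcfCls_le fun x _ => ?_).trans_lt hδε
  rw [norm_sub_rev]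
  exact (h x y hy).le

theorem BZero_subset_SO [LocallyCompactSpace G] : BZero μ ⊆ SO μ := by
  intro f hf ε hε
  obtain ⟨K, hK, hfK⟩ := hf (ε / 2) (ENNReal.half_pos hε.ne')
  obtain ⟨O, hO, hO0⟩ := exists_compact_mem_nhds (0 : G)
  -- Outside `K + O`, translation by `y ∈ O` still evaluates `f` outside `K`.
  refine ⟨K + O ∪ K, (hK.add hO).union hK, O, hO0, fun y hy => ?_⟩
  rw [sub_eq_add_neg]
  refine (normOn_add_le _ _ _).trans_lt ?_
  rw [normOn_neg, normOn_translate]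
  refine (add_le_add (normOn_mono (T := Kᶜ) ?_ f) (normOn_mono (T := Kᶜ) ?_ f)).trans_lt ?_
  · exact Set.compl_subset_compl.2 Set.subset_union_right
  · intro x hx hxK
    exact hx (Or.inl (Set.add_mem_add hxK hy))
  · exact (ENNReal.add_lt_add hfK hfK).trans_le (ENNReal.add_halves ε).le

theorem add_mem_SO {f g : LInf μ} (hf : f ∈ SO μ) (hg : g ∈ SO μ) : f + g ∈ SO μ := by
  intro ε hε
  obtain ⟨K, hK, O, hO, h⟩ := hf (ε / 2) (ENNReal.half_pos hε.ne')
  obtain ⟨L, hL, P, hP, h'⟩ := hg (ε / 2) (ENNReal.half_pos hε.ne')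
  refine ⟨K ∪ L, hK.union hL, O ∩ P, inter_mem hO hP, fun y hy => ?_⟩
  rw [map_add, add_sub_add_comm]
  refine (normOn_add_le _ _ _).trans_lt ?_
  refine (add_le_add (normOn_mono (Set.compl_subset_compl.2 Set.subset_union_left) _)
    (normOn_mono (Set.compl_subset_compl.2 Set.subset_union_right) _)).trans_lt ?_
  exact (ENNReal.add_lt_add (h y hy.1) (h' y hy.2)).trans_le (ENNReal.add_halves ε).le

theorem IsLimitFunction.add {f g h k : LInf μ} {x : Samuel G} (hf : IsLimitFunction μ f x h)
    (hg : IsLimitFunction μ g x k) : IsLimitFunction μ (f + g) x (h + k) := by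
  rw [IsLimitFunction, tendsto_tauUC_iff] at *
  intro K hK ε hε
  filter_upwards [hf K hK (ε / 2) (ENNReal.half_pos hε.ne'),
    hg K hK (ε / 2) (ENNReal.half_pos hε.ne')] with y h1 h2
  rw [map_add, add_sub_add_comm]
  refine (normOn_add_le _ _ _).trans_lt ?_
  exact (ENNReal.add_lt_add h1 h2).trans_le (ENNReal.add_halves ε).le

theorem isLimitFunction_zero {f : LInf μ} (hf : f ∈ BZero μ) {x : Samuel G}
    (hx : x ∈ boundary G) : IsLimitFunction μ f x 0 := by
  rw [IsLimitFunction, tendsto_tauUC_iff]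
  intro K hK ε hε
  obtain ⟨L, hL, h⟩ := hf ε hε
  -- For `y ∉ K - L`, the translate `L + y` is disjoint from `K`.
  filter_upwards [comap_delta_le_cocompact hx (hK.add hL.neg).compl_mem_cocompact] with y hy
  rw [sub_zero, normOn_translate]
  refine (normOn_mono ?_ f).trans_lt h
  intro z hz hzL
  exact hy ⟨z + y, hz, -z, by simpa using hzL, by simp⟩

theorem isLimitFunction_bcfCls (f : BUC G) {x : Samuel G} {h : G →ᵇ ℂ} (hh : h ∈ BUC G)
    (hx : ∀ z, h z = x (reflect f z)) : IsLimitFunction μ (bcfCls μ f) x (bcfCls μ h) := by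
  rw [IsLimitFunction, tendsto_tauUC_iff]
  intro K hK ε hε
  obtain ⟨δ, hδ, hδε⟩ := exists_ofReal_lt hε
  filter_upwards [eventually_norm_sub_lt f x hh hx hK hδ] with y hy
  exact (normOn_translate_sub_bcfCls_le hy).trans_lt hδε

theorem IsLimitFunction.unique [T2Space G] [LocallyCompactSpace G] [μ.Regular] {f h k : LInf μ}
    {x : Samuel G} (hh : IsLimitFunction μ f x h) (hk : IsLimitFunction μ f x k) : h = k := by
  rw [IsLimitFunction, tendsto_tauUC_iff] at *
  refine eq_of_forall_normOn_isCompact fun K hK => ?_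
  by_contra h0
  have hpos := ENNReal.half_pos h0
  obtain ⟨y, h1, h2⟩ := ((hh K hK _ hpos).and (hk K hK _ hpos)).exists
  rw [normOn_sub_rev] at h1
  have h3 := (normOn_sub_le K h (translate μ y f) k).trans_lt (ENNReal.add_lt_add h1 h2)
  rw [ENNReal.add_halves] at h3
  exact h3.false

theorem add_subset_BUCOne [T2Space G] [LocallyCompactSpace G] [μ.Regular] :
    BUCClass μ + BZero μ ⊆ BUCOne μ := by
  rintro _ ⟨_, hf', g, hg, rfl⟩
  obtain ⟨f, hf, rfl⟩ := mem_BUCClass_iff.1 hf'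
  have key : ∀ x ∈ boundary G, ∀ h, IsLimitFunction μ (bcfCls μ f + g) x h →
      ∃ k ∈ BUC G, bcfCls μ k = h ∧
        ∀ (c : ℝ) (O : Set G), (∀ z, ∀ y ∈ O, ‖f z - f (z - y)‖ ≤ c) →
          ∀ z, ∀ y ∈ O, ‖k z - k (z - y)‖ ≤ c := by
    intro x hx h hh
    obtain ⟨k, hk, hkx, hmod⟩ := exists_pointwise_limit ⟨f, hf⟩ x
    refine ⟨k, hk, ?_, hmod⟩
    have h1 := (isLimitFunction_bcfCls (μ := μ) ⟨f, hf⟩ hk hkx).add (isLimitFunction_zero hg hx)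
    rw [add_zero] at h1
    exact h1.unique hh
  refine ⟨?_, ?_, ?_⟩
  · intro x hx
    obtain ⟨k, hk, hkx, -⟩ := exists_pointwise_limit ⟨f, hf⟩ x
    exact ⟨_, (isLimitFunction_bcfCls (μ := μ) ⟨f, hf⟩ hk hkx).add (isLimitFunction_zero hg hx)⟩
  · intro x hx h hh
    obtain ⟨k, hk, hkh, -⟩ := key x hx h hh
    exact mem_BUCClass_iff.2 ⟨k, hk, hkh⟩
  · intro ε hε
    obtain ⟨δ, hδ, hδε⟩ := exists_ofReal_lt hε
    obtain ⟨O, hO, h⟩ := mem_BUC_iff.1 hf δ hδ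
    refine ⟨O, hO, ?_⟩
    rintro y hy h' ⟨x, hx, hh'⟩
    obtain ⟨k, hk, rfl, hmod⟩ := key x hx h' hh'
    refine (normOn_translate_sub_bcfCls_le fun z _ => ?_).trans_lt hδε
    rw [norm_sub_rev]
    exact hmod δ O (fun z y hy => (h z y hy).le) z y hy

end Inclusions

/-! ### The inclusion of BUC_1 in SO -/

section BUCOneSubsetSO

variable {G : Type*} [AddCommGroup G] [TopologicalSpace G] [IsTopologicalAddGroup G]
  [LocallyCompactSpace G] [T2Space G]

omit [T2Space G] in
/-- Complex valued bump functions in `BUC(G)`. -/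
theorem exists_bump {K V : Set G} (hK : IsCompact K) (hV : IsOpen V) (hKV : K ⊆ V) :
    ∃ (u : C(G, ℝ)) (ψ : G →ᵇ ℂ), ψ ∈ BUC G ∧ (∀ x, ψ x = u x) ∧ (∀ x ∈ K, u x = 1) ∧
      IsCompact (tsupport u) ∧ tsupport u ⊆ V ∧ ∀ x, u x ∈ Set.Icc (0 : ℝ) 1 := by
  obtain ⟨u, hu1, huc, huV, hu⟩ := exists_continuousMap_one_of_isCompact_subset_isOpen hK hV hKV
  obtain ⟨ψ, hψ, hψu⟩ := exists_mem_BUC (u := fun x => (u x : ℂ)) (C := 1)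
    (fun x => by
      rw [Complex.norm_real, Real.norm_eq_abs, abs_of_nonneg (hu x).1]
      exact (hu x).2)
    (by
      intro ε hε
      obtain ⟨O, hO, h⟩ := exists_nhds_of_hasCompactSupport u.continuous huc hε
      refine ⟨O, hO, fun x y hy => ?_⟩
      rw [← Complex.ofReal_sub, Complex.norm_real]
      exact h x y hy)
  exact ⟨u, ψ, hψ, hψu, hu1, huc, huV, hu⟩

omit [T2Space G] in
-- A compactly supported bump equal to 1 at `w` tends to 0 along `V`, so the limit character cannot
-- be evaluation at `w`.
theorem mem_boundary_of_tendsto {V : Filter G} [V.NeBot] (hV : V ≤ cocompact G) {x : Samuel G}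
    (hx : Tendsto delta V (𝓝 x)) : x ∈ boundary G := by
  rintro ⟨w, rfl⟩
  obtain ⟨u, ψ, hψ, hψu, hu1, huc, -, -⟩ :=
    exists_bump (isCompact_singleton (x := w)) isOpen_univ (Set.subset_univ _)
  have h1 : Tendsto (fun y => ψ y) V (𝓝 (ψ w)) :=
    ((continuous_eval_samuel ⟨ψ, hψ⟩).tendsto (delta w)).comp hx
  have h2 : (fun y => ψ y) =ᶠ[V] fun _ => 0 := by
    filter_upwards [hV huc.compl_mem_cocompact] with y hy
    rw [hψu, image_eq_zero_of_notMem_tsupport hy, Complex.ofReal_zero]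
  have h3 : ψ w = 0 := tendsto_nhds_unique (h1.congr' h2) tendsto_const_nhds
  rw [hψu, hu1 w rfl, Complex.ofReal_one] at h3
  exact one_ne_zero h3

variable [MeasurableSpace G] [BorelSpace G] {μ : Measure G} [μ.IsAddHaarMeasure]

theorem BUCOne_subset_SO [μ.Regular] : BUCOne μ ⊆ SO μ := by
  rintro f ⟨hlim, -, heq⟩ ε hε
  obtain ⟨δ, hδ, hδε⟩ := exists_ofReal_lt hε
  set d : ℝ≥0∞ := ENNReal.ofReal δ
  have hd : 0 < d / 3 := ENNReal.div_pos (ENNReal.ofReal_pos.2 hδ).ne' (by simp)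
  obtain ⟨O, hO, hfO⟩ := heq (d / 3) hd
  obtain ⟨P, hP, hPO, hPc⟩ := local_compact_nhds hO
  obtain ⟨W, hW, hW0⟩ := exists_compact_mem_nhds (0 : G)
  -- The bad points: some translation in `P` changes `f` by more than `d` on `z + W`. The claim is
  -- that they lie in a compact set.
  let B : Set G := {z | ∃ y ∈ P, d < normOn μ W
    (translate μ (-z) f - translate μ y (translate μ (-z) f))}
  have hB : ∃ K : Set G, IsCompact K ∧ Kᶜ ⊆ Bᶜ := by
    by_contra! hcon
    have hne : (cocompact G ⊓ 𝓟 B).NeBot := by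
      rw [neBot_iff]
      intro hbot
      obtain ⟨K, hK, hKB⟩ := mem_cocompact.1
        (mem_iff_inf_principal_compl.2 (by rwa [compl_compl]) : Bᶜ ∈ cocompact G)
      exact hcon K hK hKB
    let U : Ultrafilter G := Ultrafilter.of (cocompact G ⊓ 𝓟 B)
    have hU : (U : Filter G) ≤ cocompact G ⊓ 𝓟 B := Ultrafilter.of_le _
    -- The piece of `f` near `z` is moved to the origin by translating by `-z`, so the limit is
    -- taken along `-z`.
    let V : Ultrafilter G := U.map (fun z => -z)
    have hV : (V : Filter G) ≤ cocompact G := by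
      have : Tendsto (fun z : G => -z) (cocompact G) (cocompact G) :=
        (Homeomorph.neg G).isClosedEmbedding.tendsto_cocompact
      exact this.mono_left (hU.trans inf_le_left)
    obtain ⟨x, -, hx⟩ := isCompact_univ.ultrafilter_le_nhds (V.map (delta : G → Samuel G)) (by simp)
    have hxb : x ∈ boundary G := mem_boundary_of_tendsto hV hx
    obtain ⟨h, hh⟩ := hlim x hxb
    -- On `W`, a translate by `y ∈ P` sees values on `W - P`; compactness of `P` keeps this set
    -- compact.
    have hW' : IsCompact ((W + -P) ∪ W) := (hW.add hPc.neg).union hW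
    have h1 := tendsto_tauUC_iff.1 hh _ hW' (d / 3) hd
    have h2 : ∀ᶠ y in (V : Filter G), normOn μ ((W + -P) ∪ W) (translate μ y f - h) < d / 3 :=
      (tendsto_iff_comap.1 hx) h1
    have h3 : ∀ᶠ z in (U : Filter G),
        normOn μ ((W + -P) ∪ W) (translate μ (-z) f - h) < d / 3 := h2
    have h4 : ∀ᶠ z in (U : Filter G), z ∈ B := (hU.trans inf_le_right) (mem_principal_self B)
    obtain ⟨z, hz, y, hy, hzB⟩ := (h3.and h4).exists
    set a := translate μ (-z) f
    have e1 : normOn μ W (a - h) < d / 3 :=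
      (normOn_mono Set.subset_union_right _).trans_lt hz
    have e2 : normOn μ W (h - translate μ y h) < d / 3 := by
      rw [normOn_sub_rev]
      exact (normOn_mono (Set.subset_univ _) _).trans_lt (hfO y (hPO hy) h ⟨x, hxb, hh⟩)
    have e3 : normOn μ W (translate μ y h - translate μ y a) < d / 3 := by
      rw [← map_sub, normOn_translate, normOn_sub_rev]
      refine (normOn_mono ?_ _).trans_lt hz
      intro w hw
      exact Or.inl ⟨w + y, hw, -y, by simpa using hy, by simp⟩
    have e4 := (normOn_sub_le W a (translate μ y h) (translate μ y a)).trans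
      (add_le_add_left (normOn_sub_le W a h (translate μ y h)) _)
    have e5 := e4.trans_lt (ENNReal.add_lt_add (ENNReal.add_lt_add e1 e2) e3)
    rw [ENNReal.add_thirds] at e5
    exact (hzB.trans e5).false
  obtain ⟨K, hK, hKB⟩ := hB
  refine ⟨K, hK, P, hP, fun y hy => lt_of_le_of_lt ?_ hδε⟩
  -- The bounds on the sets `z + W` glue to one bound on `Kᶜ`, since the local supremum is computed
  -- locally.
  refine normOn_le_of_forall_nhds hK.isClosed.isOpen_compl.measurableSet fun z hz => ?_
  refine ⟨(fun x => x + -z) ⁻¹' W, ?_, ?_⟩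
  · have : Continuous fun x : G => x + -z := by fun_prop
    exact this.continuousAt.preimage_mem_nhds (by simpa using hW0)
  · rw [← normOn_translate, map_sub]
    have h1 : z ∉ B := hKB hz
    have h2 : ¬ d < normOn μ W (translate μ (-z) f - translate μ y (translate μ (-z) f)) :=
      fun h => h1 ⟨y, hy, h⟩
    rw [translate_translate, add_comm y, ← translate_translate] at h2
    exact not_lt.1 h2

end BUCOneSubsetSO

/-! ### Integration against test functions and recovery of essential bounds -/

section Convolution

variable {G : Type*} [TopologicalSpace G] [MeasurableSpace G] [BorelSpace G] [T2Space G]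
  {μ : Measure G}

omit [TopologicalSpace G] [BorelSpace G] [T2Space G] in
theorem LocMeasurable.measurable_indicator {f : G → ℂ} (hf : LocMeasurable μ f) {F : Set G}
    (hF : MeasurableSet F) (hF' : μ F < ∞) : Measurable (F.indicator f) := by
  intro A hA
  rw [Set.indicator_preimage]
  refine MeasurableSet.union (hf A hA F hF hF') (MeasurableSet.diff ?_ hF)
  exact measurable_const hA

variable [IsFiniteMeasureOnCompacts μ]

theorem integrable_mul_of_hasCompactSupport {f : G → ℂ} (hf : LocMeasurable μ f) {C : ℝ}
    (hC : ∀ x, ‖f x‖ ≤ C) {k : G → ℂ} (hk : Continuous k) (hkc : HasCompactSupport k) :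
    Integrable (fun x => k x * f x) μ := by
  have hm := hf.measurable_indicator hkc.isCompact.isClosed.measurableSet
    hkc.isCompact.measure_lt_top
  have h1 := (hk.integrable_of_hasCompactSupport (μ := μ) hkc).mul_bdd (c := C)
    hm.aestronglyMeasurable (Eventually.of_forall fun x =>
      (norm_indicator_le_norm_self _ _).trans (hC x))
  refine h1.congr (Eventually.of_forall fun x => ?_)
  by_cases hx : x ∈ tsupport k
  · simp [hx]
  · simp [image_eq_zero_of_notMem_tsupport hx]

omit [T2Space G] in
theorem norm_integral_mul_le {f : G → ℂ} {C : ℝ}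
    (hC : ∀ x, ‖f x‖ ≤ C) {k : G → ℂ} (hk : Continuous k) (hkc : HasCompactSupport k) :
    ‖∫ x, k x * f x ∂μ‖ ≤ C * ∫ x, ‖k x‖ ∂μ := by
  rw [← integral_const_mul]
  refine norm_integral_le_of_norm_le
    ((hk.integrable_of_hasCompactSupport hkc).norm.const_mul C) (Eventually.of_forall fun x => ?_)
  rw [norm_mul, mul_comm]
  exact mul_le_mul_of_nonneg_right (hC x) (norm_nonneg _)

/-- Fubini's theorem for the product of a continuous compactly supported kernel and a bounded
locally measurable function. -/
theorem integral_integral_mul_swap {f : G → ℂ} (hf : LocMeasurable μ f) {C : ℝ}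
    (hC : ∀ x, ‖f x‖ ≤ C) {F : G × G → ℂ} (hF : Continuous F) (hFc : HasCompactSupport F) :
    ∫ x, ∫ t, F (x, t) * f t ∂μ ∂μ = ∫ t, ∫ x, F (x, t) * f t ∂μ ∂μ := by
  let K : Set G := Prod.fst '' tsupport F
  let L : Set G := Prod.snd '' tsupport F
  have hK : IsCompact K := hFc.isCompact.image continuous_fst
  have hL : IsCompact L := hFc.isCompact.image continuous_snd
  have hFK : ∀ x t, x ∉ K → F (x, t) = 0 := fun x t hx =>
    image_eq_zero_of_notMem_tsupport fun h => hx ⟨_, h, rfl⟩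
  have hFL : ∀ x t, t ∉ L → F (x, t) = 0 := fun x t ht =>
    image_eq_zero_of_notMem_tsupport fun h => ht ⟨_, h, rfl⟩
  have hm : Measurable (L.indicator f) :=
    hf.measurable_indicator hL.isClosed.measurableSet hL.measure_lt_top
  have hfL : ∀ x t, F (x, t) * f t = F (x, t) * L.indicator f t := by
    intro x t
    by_cases ht : t ∈ L
    · simp [ht]
    · simp [hFL x t ht]
  simp_rw [hfL]
  -- Restricting to `K` and `L` makes both measures finite, as Fubini requires; truncating `f` to
  -- `L` has made it measurable.
  have : Fact (μ K < ∞) := ⟨hK.measure_lt_top⟩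
  have : Fact (μ L < ∞) := ⟨hL.measure_lt_top⟩
  obtain ⟨M, hM⟩ := hFc.exists_bound_of_continuous hF
  have hint : Integrable (Function.uncurry fun x t => F (x, t) * L.indicator f t)
      ((μ.restrict K).prod (μ.restrict L)) := by
    refine Integrable.of_bound (C := M * C) ?_ (Eventually.of_forall fun p => ?_)
    · exact ((hFc.stronglyMeasurable_of_prod hF).mul
        (hm.comp measurable_snd).stronglyMeasurable).aestronglyMeasurable
    · change ‖F (p.1, p.2) * L.indicator f p.2‖ ≤ _
      rw [norm_mul]
      exact mul_le_mul (hM _) ((norm_indicator_le_norm_self _ _).trans (hC _)) (norm_nonneg _)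
        ((norm_nonneg _).trans (hM p))
  calc ∫ x, ∫ t, F (x, t) * L.indicator f t ∂μ ∂μ
      = ∫ x in K, ∫ t in L, F (x, t) * L.indicator f t ∂μ ∂μ := by
        rw [setIntegral_eq_integral_of_forall_compl_eq_zero (s := K)]
        · refine integral_congr_ae (Eventually.of_forall fun x => ?_)
          exact (setIntegral_eq_integral_of_forall_compl_eq_zero fun t ht => by
            rw [hFL x t ht, zero_mul]).symm
        · intro x hx
          simp [hFK x _ hx]
    _ = ∫ t in L, ∫ x in K, F (x, t) * L.indicator f t ∂μ ∂μ := integral_integral_swap hint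
    _ = ∫ t, ∫ x, F (x, t) * L.indicator f t ∂μ ∂μ := by
        rw [setIntegral_eq_integral_of_forall_compl_eq_zero (s := L)]
        · refine integral_congr_ae (Eventually.of_forall fun t => ?_)
          exact setIntegral_eq_integral_of_forall_compl_eq_zero fun x hx => by
            rw [hFK x t hx, zero_mul]
        · intro t ht
          simp [hFL _ t ht]

omit [IsFiniteMeasureOnCompacts μ] in
/-- If the integrals of `f` against nonnegative test functions `v` supported in an open set `U` are
bounded by `ε * ∫ v`, then the real part of `f` is locally almost everywhere at most `ε` on `U`. -/
theorem eventually_re_mul_le [LocallyCompactSpace G] [μ.Regular] {f : G → ℂ}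
    (hf : LocMeasurable μ f) {C : ℝ} (hC : ∀ x, ‖f x‖ ≤ C) {U : Set G} (hU : IsOpen U) {ε : ℝ}
    (h : ∀ v : C(G, ℝ), HasCompactSupport v → tsupport v ⊆ U → (∀ x, 0 ≤ v x) →
      ‖∫ x, (v x : ℂ) * f x ∂μ‖ ≤ ε * ∫ x, v x ∂μ) {c : ℂ} (hc : ‖c‖ = 1) :
    ∀ᶠ x in lae μ, x ∈ U → (c * f x).re ≤ ε := by
  have e : {x | x ∈ U → (c * f x).re ≤ ε}ᶜ = U ∩ f ⁻¹' {z | ε < (c * z).re} := by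
    ext x
    simp [-Complex.mul_re]
  change LocNull μ _
  rw [e]
  refine locNull_of_forall_isCompact (fun F hF hF' => measurableSet_inter_of_locMeasurable hf
    (measurableSet_lt measurable_const (by fun_prop)) hU.measurableSet hF hF') fun K hK hKU => ?_
  by_contra hK0
  have hKm : MeasurableSet K := hK.isClosed.measurableSet
  set w : G → ℝ := fun x => (c * f x).re
  have hw : ∀ x, |w x| ≤ C := fun x => (Complex.abs_re_le_norm _).trans (by
    rw [norm_mul, hc, one_mul]
    exact hC x)
  have hwK : IntegrableOn w K μ := by
    have h1 : IntegrableOn (K.indicator f) K μ := by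
      have : Fact (μ K < ∞) := ⟨hK.measure_lt_top⟩
      exact Integrable.of_bound (C := C)
        (hf.measurable_indicator hKm hK.measure_lt_top).aestronglyMeasurable
        (Eventually.of_forall fun x => (norm_indicator_le_norm_self _ _).trans (hC x))
    have h2 : IntegrableOn f K μ := h1.congr_fun (fun x hx => by simp [hx]) hKm
    exact (h2.const_mul c).re
  have hdK : IntegrableOn (fun x => w x - ε) K μ :=
    hwK.sub (integrableOn_const hK.measure_lt_top.ne)
  have hpos : 0 < ∫ x in K, (w x - ε) ∂μ := by
    rw [setIntegral_pos_iff_support_of_nonneg_ae _ hdK]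
    · have : Function.support (fun x => w x - ε) ∩ K = K :=
        Set.inter_eq_right.2 fun x hx => (sub_pos.2 (hKU hx).2).ne'
      rw [this]
      exact pos_iff_ne_zero.2 hK0
    · exact (ae_restrict_iff' hKm).2 (Eventually.of_forall fun x hx => (sub_pos.2 (hKU hx).2).le)
  set I := ∫ x in K, (w x - ε) ∂μ
  have hCC : 0 ≤ C := by
    by_contra! hneg
    have : K = ∅ := Set.eq_empty_of_forall_notMem fun x _ =>
      absurd ((norm_nonneg _).trans (hC x)) (not_le.2 hneg)
    simp [this] at hK0
  -- `M` dominates `|w - ε|`, and `V` is chosen with `M * μ (V \ K) ≤ I / 2`: the excess `I` over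
  -- `K` then survives replacing the indicator of `K` by `v`.
  set M := C + |ε| + 1
  have hM : 0 < M := by positivity
  obtain ⟨V, hKV, hV, hμV⟩ := K.exists_isOpen_lt_add hK.measure_lt_top.ne (μ := μ)
    (ε := ENNReal.ofReal (I / (2 * M))) (ENNReal.ofReal_pos.2 (by positivity)).ne'
  obtain ⟨v, hv1, hvc, hvV, hv⟩ := exists_continuousMap_one_of_isCompact_subset_isOpen hK
    (hV.inter hU) (Set.subset_inter hKV fun x hx => (hKU hx).1)
  replace hvc : HasCompactSupport v := hvc
  have hint1 : Integrable (fun x => v x * w x) μ := by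
    have h1 := (integrable_mul_of_hasCompactSupport (μ := μ) hf hC
      (k := fun x => c * (v x : ℂ)) (by fun_prop)
      (HasCompactSupport.mul_left (hvc.comp_left Complex.ofReal_zero))).re
    refine h1.congr (Eventually.of_forall fun x => ?_)
    change (c * (v x : ℂ) * f x).re = v x * (c * f x).re
    rw [mul_right_comm, mul_comm, Complex.re_ofReal_mul]
  have hint2 : Integrable v μ := v.continuous.integrable_of_hasCompactSupport hvc
  have hle : ∫ x, v x * w x ∂μ ≤ ε * ∫ x, v x ∂μ := by
    have h1 : ∫ x, v x * w x ∂μ = (c * ∫ x, (v x : ℂ) * f x ∂μ).re := by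
      have h2 := integral_re ((integrable_mul_of_hasCompactSupport (μ := μ) hf hC
        (k := fun x => (v x : ℂ)) (by fun_prop) (hvc.comp_left Complex.ofReal_zero)).const_mul c)
      rw [← integral_const_mul]
      refine Eq.trans (integral_congr_ae (Eventually.of_forall fun x => ?_)) h2
      change v x * (c * f x).re = (c * ((v x : ℂ) * f x)).re
      rw [mul_left_comm, Complex.re_ofReal_mul]
    rw [h1]
    refine (Complex.re_le_norm _).trans ?_
    rw [norm_mul, hc, one_mul]
    exact h v hvc (hvV.trans Set.inter_subset_right) fun x => (hv x).1
  have hμVK : μ (V \ K) < ENNReal.ofReal (I / (2 * M)) :=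
    measure_sdiff_lt_of_lt_add hKm.nullMeasurableSet hKV hK.measure_lt_top.ne hμV
  have hVK : MeasurableSet (V \ K) := hV.measurableSet.diff hKm
  have hlow : ∫ x, (K.indicator (fun x => w x - ε) x - (V \ K).indicator (fun _ => M) x) ∂μ ≤
      ∫ x, (v x * w x - ε * v x) ∂μ := by
    refine integral_mono ((hdK.integrable_indicator hKm).sub
      ((integrableOn_const hμVK.ne_top).integrable_indicator hVK))
      (hint1.sub (hint2.const_mul ε)) fun x => ?_
    simp only
    by_cases hxK : x ∈ K
    · have hv1x : v x = 1 := hv1 hxK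
      simp [hxK, hv1x]
    · by_cases hxV : x ∈ V
      · simp only [hxK, not_false_eq_true, Set.indicator_of_notMem, Set.mem_sdiff, hxV, and_self,
          Set.indicator_of_mem, zero_sub]
        have h1 : |v x * w x - ε * v x| ≤ M := by
          rw [mul_comm ε, ← mul_sub, abs_mul, abs_of_nonneg (hv x).1]
          have h2 : |w x - ε| ≤ M := (abs_sub _ _).trans (by linarith [hw x])
          calc v x * |w x - ε| ≤ 1 * M :=
                mul_le_mul (hv x).2 h2 (abs_nonneg _) zero_le_one
            _ = M := one_mul M
        exact (abs_le.1 h1).1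
      · have : v x = 0 := image_eq_zero_of_notMem_tsupport fun hx => hxV (hvV hx).1
        simp [hxK, hxV, this]
  rw [integral_sub (hdK.integrable_indicator hKm)
    ((integrableOn_const hμVK.ne_top).integrable_indicator hVK),
    integral_sub hint1 (hint2.const_mul ε), integral_const_mul, integral_indicator hKm,
    integral_indicator hVK, setIntegral_const, smul_eq_mul] at hlow
  have hreal : μ.real (V \ K) * M ≤ I / 2 := by
    have h1 : μ.real (V \ K) ≤ I / (2 * M) :=
      ENNReal.toReal_le_of_le_ofReal (by positivity) hμVK.le
    calc μ.real (V \ K) * M ≤ I / (2 * M) * M := by gcongr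
      _ = I / 2 := by field_simp
  linarith

omit [IsFiniteMeasureOnCompacts μ] in
-- Bounding the real part of `c * f` for `c = ±1, ±I` controls real and imaginary parts; the factor
-- 2 comes from adding the two.
theorem eventually_norm_le_two_mul [LocallyCompactSpace G] [μ.Regular] {f : G → ℂ}
    (hf : LocMeasurable μ f) {C : ℝ} (hC : ∀ x, ‖f x‖ ≤ C) {U : Set G} (hU : IsOpen U) {ε : ℝ}
    (h : ∀ v : C(G, ℝ), HasCompactSupport v → tsupport v ⊆ U → (∀ x, 0 ≤ v x) →
      ‖∫ x, (v x : ℂ) * f x ∂μ‖ ≤ ε * ∫ x, v x ∂μ) :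
    ∀ᶠ x in lae μ, x ∈ U → ‖f x‖ ≤ 2 * ε := by
  filter_upwards [eventually_re_mul_le hf hC hU h (c := 1) (by simp),
    eventually_re_mul_le hf hC hU h (c := -1) (by simp),
    eventually_re_mul_le hf hC hU h (c := Complex.I) (by simp),
    eventually_re_mul_le hf hC hU h (c := -Complex.I) (by simp)] with x h1 h2 h3 h4 hx
  have h1 := h1 hx
  have h2 := h2 hx
  have h3 := h3 hx
  have h4 := h4 hx
  simp only [one_mul, neg_mul, Complex.neg_re, Complex.I_mul_re, neg_neg] at h1 h2 h3 h4
  have h5 : |(f x).re| ≤ ε := abs_le.2 ⟨by linarith, h1⟩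
  have h6 : |(f x).im| ≤ ε := abs_le.2 ⟨by linarith, h4⟩
  linarith [Complex.norm_le_abs_re_add_abs_im (f x)]

end Convolution

/-! ### Convolution on the group -/

section ConvolutionGroup

variable {G : Type*} [AddCommGroup G] [TopologicalSpace G] [IsTopologicalAddGroup G]
  [LocallyCompactSpace G] [T2Space G] [MeasurableSpace G] [BorelSpace G]
  {μ : Measure G} [μ.IsAddHaarMeasure] [μ.Regular]

omit [T2Space G] [μ.Regular] in
theorem tendsto_integral_norm_sub_translate {φ : G → ℂ} (hφ : Continuous φ)
    (hφc : HasCompactSupport φ) :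
    Tendsto (fun s => ∫ t, ‖φ t - φ (t - s)‖ ∂μ) (𝓝 0) (𝓝 0) := by
  obtain ⟨N, hN, hN0⟩ := exists_compact_mem_nhds (0 : G)
  have hc : ContinuousOn (fun s => ∫ t, ‖φ t - φ (t - s)‖ ∂μ) N := by
    refine continuousOn_integral_of_compact_support
      (k := (tsupport φ + N) ∪ tsupport φ) ((hφc.isCompact.add hN).union hφc.isCompact) ?_ ?_
    · exact Continuous.continuousOn (by unfold Function.uncurry; fun_prop)
    · intro s t hs ht
      have h1 : φ t = 0 := image_eq_zero_of_notMem_tsupport fun h => ht (Or.inr h)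
      have h2 : φ (t - s) = 0 := image_eq_zero_of_notMem_tsupport fun h =>
        ht (Or.inl ⟨t - s, h, s, hs, by simp⟩)
      simp [h1, h2]
  have := (hc.continuousAt hN0).tendsto
  simpa using this

omit [LocallyCompactSpace G] [T2Space G] [MeasurableSpace G] [BorelSpace G] in
theorem hasCompactSupport_comp_sub {φ : G → ℂ} (hφc : HasCompactSupport φ) (x : G) :
    HasCompactSupport fun t => φ (x - t) :=
  hφc.comp_homeomorph (Homeomorph.subLeft x)

/-- By invariance of `μ`, a shift by `s` changes the convolution by at most `C` times the `L¹`
distance of `φ` from its translate, uniformly in `x`. -/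
theorem exists_mem_BUC_conv {f : G → ℂ} (hf : LocMeasurable μ f) {C : ℝ} (hC : ∀ x, ‖f x‖ ≤ C)
    {φ : G → ℂ} (hφ : Continuous φ) (hφc : HasCompactSupport φ) :
    ∃ g ∈ BUC G, ∀ x, g x = ∫ t, φ (x - t) * f t ∂μ := by
  have hsub : ∀ x, Continuous fun t => φ (x - t) := fun x => by fun_prop
  refine exists_mem_BUC (u := fun x => ∫ t, φ (x - t) * f t ∂μ) (C := C * ∫ t, ‖φ t‖ ∂μ) ?_ ?_
  · intro x
    refine (norm_integral_mul_le hC (hsub x) (hasCompactSupport_comp_sub hφc x)).trans_eq ?_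
    rw [integral_sub_left_eq_self (fun t => ‖φ t‖) μ x]
  · intro ε hε
    have h1 : Tendsto (fun s => C * ∫ t, ‖φ t - φ (t - s)‖ ∂μ) (𝓝 0) (𝓝 0) := by
      simpa using (tendsto_integral_norm_sub_translate (μ := μ) hφ hφc).const_mul C
    refine ⟨_, h1.eventually_lt_const hε, fun x s hs => lt_of_le_of_lt ?_ hs⟩
    have hi := fun x => integrable_mul_of_hasCompactSupport hf hC (hsub x)
      (hasCompactSupport_comp_sub hφc x)
    rw [← integral_sub (hi x) (hi (x - s))]
    simp_rw [← sub_mul]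
    refine (norm_integral_mul_le hC ((hsub x).sub (hsub (x - s)))
      ((hasCompactSupport_comp_sub hφc x).sub (hasCompactSupport_comp_sub hφc (x - s)))).trans_eq ?_
    rw [← integral_sub_left_eq_self (fun t => ‖φ t - φ (t - s)‖) μ x]
    simp_rw [sub_right_comm x s]
    rfl

omit [LocallyCompactSpace G] [μ.Regular] in
-- Two Fubini swaps, with changes of variable arranged so that `f` always depends on one integration
-- variable only; joint measurability of `f (x - s)` is never needed.
theorem integral_mul_conv {f : G → ℂ} (hf : LocMeasurable μ f) {C : ℝ} (hC : ∀ x, ‖f x‖ ≤ C)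
    {φ h : G → ℂ} (hφ : Continuous φ) (hφc : HasCompactSupport φ) (hh : Continuous h)
    (hhc : HasCompactSupport h) :
    ∫ x, h x * ∫ t, φ (x - t) * f t ∂μ ∂μ = ∫ s, φ s * ∫ x, h x * f (x - s) ∂μ ∂μ := by
  have hAB := hhc.isCompact.add hφc.isCompact.neg
  have s1 := integral_integral_mul_swap hf hC (F := fun p => h p.1 * φ (p.1 - p.2))
    (by fun_prop) (HasCompactSupport.intro (hhc.isCompact.prod hAB) (by
      rintro ⟨x, t⟩ hxt
      by_contra h0
      have h1 := subset_tsupport _ (left_ne_zero_of_mul h0 : h x ≠ 0)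
      have h2 := subset_tsupport _ (right_ne_zero_of_mul h0 : φ (x - t) ≠ 0)
      exact hxt ⟨h1, x, h1, -(x - t), by simpa using h2, by simp⟩))
  have s2 := integral_integral_mul_swap hf hC (F := fun p => φ p.1 * h (p.2 + p.1))
    (by fun_prop) (HasCompactSupport.intro (hφc.isCompact.prod hAB) (by
      rintro ⟨s, t⟩ hxt
      by_contra h0
      have h1 := subset_tsupport _ (left_ne_zero_of_mul h0 : φ s ≠ 0)
      have h2 := subset_tsupport _ (right_ne_zero_of_mul h0 : h (t + s) ≠ 0)
      exact hxt ⟨h1, t + s, h2, -s, by simpa using h1, by simp⟩))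
  have e1 : ∀ t, ∫ x, h x * φ (x - t) * f t ∂μ = ∫ s, φ s * h (t + s) * f t ∂μ := by
    intro t
    rw [← integral_add_right_eq_self _ t]
    refine integral_congr_ae (Eventually.of_forall fun s => ?_)
    simp only [add_comm s t, add_sub_cancel_left]
    ring
  have e2 : ∀ s, ∫ x, h x * f (x - s) ∂μ = ∫ t, h (t + s) * f t ∂μ := by
    intro s
    rw [← integral_add_right_eq_self _ s]
    simp only [add_sub_cancel_right]
  simp_rw [e2, ← integral_const_mul, ← mul_assoc]
  rw [s1, s2]
  exact integral_congr_ae (Eventually.of_forall e1)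

/-- If the translates of `f` by the support of `φ` are uniformly `ε`-close to `f` on `U`, then so
is the convolution of `f` and `φ`, in the weak sense. -/
theorem norm_integral_mul_sub_conv_le {f : G → ℂ} (hf : LocMeasurable μ f) {C : ℝ}
    (hC : ∀ x, ‖f x‖ ≤ C) {u v : C(G, ℝ)} (hu : HasCompactSupport u) (hv : HasCompactSupport v)
    (hu0 : ∀ x, 0 ≤ u x) (hv0 : ∀ x, 0 ≤ v x) (hu1 : ∫ x, u x ∂μ = 1) {ε : ℝ}
    (hε : ∀ s ∈ tsupport u, ∀ᶠ x in lae μ, x ∈ tsupport v → ‖f x - f (x - s)‖ ≤ ε) :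
    ‖∫ x, (v x : ℂ) * (f x - ∫ t, (u (x - t) : ℂ) * f t ∂μ) ∂μ‖ ≤ ε * ∫ x, v x ∂μ := by
  have hcu : Continuous fun x => (u x : ℂ) := by fun_prop
  have hcv : Continuous fun x => (v x : ℂ) := by fun_prop
  have hu' : HasCompactSupport fun x => (u x : ℂ) := hu.comp_left Complex.ofReal_zero
  have hv' : HasCompactSupport fun x => (v x : ℂ) := hv.comp_left Complex.ofReal_zero
  have hft : ∀ s, LocMeasurable μ fun x => f (x - s) := fun s =>
    (translate_mem μ s ⟨hf, C, Eventually.of_forall hC⟩).1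
  have i1 := integrable_mul_of_hasCompactSupport (μ := μ) hf hC hcv hv'
  have i2 := fun s => integrable_mul_of_hasCompactSupport (μ := μ) (hft s) (fun x => hC (x - s))
    hcv hv'
  obtain ⟨g, -, hg⟩ := exists_mem_BUC_conv (μ := μ) hf hC hcu hu'
  have i3 : Integrable (fun x => (v x : ℂ) * ∫ t, (u (x - t) : ℂ) * f t ∂μ) μ := by
    simp_rw [← hg]
    exact (hcv.mul g.continuous).integrable_of_hasCompactSupport hv'.mul_right
  -- The pairing of `v` with translates of `f` is itself a convolution, hence continuous in `s`,
  -- hence integrable against `u`.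
  obtain ⟨k, -, hk⟩ := exists_mem_BUC_conv (μ := μ) hf hC (φ := fun x => (v (-x) : ℂ))
    (by fun_prop) (hv'.comp_homeomorph (Homeomorph.neg G))
  have hkJ : ∀ s, ∫ x, (v x : ℂ) * f (x - s) ∂μ = k (-s) := by
    intro s
    rw [hk, ← integral_add_right_eq_self _ s]
    refine integral_congr_ae (Eventually.of_forall fun t => ?_)
    simp [sub_eq_add_neg, add_comm]
  have i4 : Integrable (fun s => (u s : ℂ) * ∫ x, (v x : ℂ) * f (x - s) ∂μ) μ := by
    simp_rw [hkJ]
    exact (hcu.mul (k.continuous.comp continuous_neg)).integrable_of_hasCompactSupport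
      hu'.mul_right
  have i5 : Integrable (fun s => (u s : ℂ) * ∫ x, (v x : ℂ) * f x ∂μ) μ :=
    (hcu.integrable_of_hasCompactSupport hu').mul_const _
  have hu1' : ∫ s, (u s : ℂ) ∂μ = 1 := by
    rw [integral_complex_ofReal, hu1, Complex.ofReal_one]
  have e1 : ∫ x, (v x : ℂ) * (f x - ∫ t, (u (x - t) : ℂ) * f t ∂μ) ∂μ =
      ∫ s, (u s : ℂ) * ∫ x, (v x : ℂ) * (f x - f (x - s)) ∂μ ∂μ := by
    simp_rw [mul_sub]
    rw [integral_sub i1 i3, integral_mul_conv hf hC hcu hu' hcv hv']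
    simp_rw [fun s => integral_sub i1 (i2 s), mul_sub]
    rw [integral_sub i5 i4, integral_mul_const, hu1', one_mul]
  rw [e1]
  have hvi : Integrable v μ := v.continuous.integrable_of_hasCompactSupport hv
  have e2 : ε * ∫ x, v x ∂μ = ∫ s, u s * (ε * ∫ x, v x ∂μ) ∂μ := by
    rw [integral_mul_const, hu1, one_mul]
  rw [e2]
  refine norm_integral_le_of_norm_le
    ((u.continuous.integrable_of_hasCompactSupport hu).mul_const _)
    (Eventually.of_forall fun s => ?_)
  rw [norm_mul, Complex.norm_real, Real.norm_eq_abs, abs_of_nonneg (hu0 s)]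
  by_cases hs : s ∈ tsupport u
  · refine mul_le_mul_of_nonneg_left ?_ (hu0 s)
    rw [← integral_const_mul]
    refine norm_integral_le_of_norm_le (hvi.const_mul ε) ?_
    have h1 : LocNull μ _ := hε s hs
    have h2 := h1 (tsupport v) hv.isCompact.isClosed.measurableSet hv.isCompact.measure_lt_top
    have h3 : ∀ᵐ x ∂μ, x ∉ {x | x ∈ tsupport v → ‖f x - f (x - s)‖ ≤ ε}ᶜ ∩ tsupport v :=
      measure_eq_zero_iff_ae_notMem.1 h2
    filter_upwards [h3] with x hx
    by_cases hxv : x ∈ tsupport v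
    · have h4 : ‖f x - f (x - s)‖ ≤ ε := by
        by_contra h5
        exact hx ⟨fun h6 => h5 (h6 hxv), hxv⟩
      rw [norm_mul, Complex.norm_real, Real.norm_eq_abs, abs_of_nonneg (hv0 x), mul_comm]
      exact mul_le_mul_of_nonneg_right h4 (hv0 x)
    · simp [image_eq_zero_of_notMem_tsupport hxv]
  · simp [image_eq_zero_of_notMem_tsupport hs]

end ConvolutionGroup

/-! ### The decomposition of slowly oscillating functions -/

section Decomposition

variable {G : Type*} [AddCommGroup G] [TopologicalSpace G] [IsTopologicalAddGroup G]
  [LocallyCompactSpace G] [T2Space G] [MeasurableSpace G] [BorelSpace G] {μ : Measure G}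

omit [AddCommGroup G] [TopologicalSpace G] [IsTopologicalAddGroup G]
  [LocallyCompactSpace G] [T2Space G] [BorelSpace G] in
-- Truncating values of norm above the essential bound to zero gives a bound at every point, as the
-- integral estimates require.
theorem exists_bounded_representative (f : LInf μ) :
    ∃ (g : LInfFun μ) (C : ℝ), (∀ x, ‖(g : G → ℂ) x‖ ≤ C) ∧ cls μ g = f := by
  obtain ⟨f, rfl⟩ := cls_surjective f
  obtain ⟨hf, C, hC⟩ := f.2
  let θ : ℂ → ℂ := fun z => if ‖z‖ ≤ C then z else 0
  have hθ : Measurable θ :=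
    Measurable.ite (measurableSet_le measurable_norm measurable_const) measurable_id
      measurable_const
  have hb : ∀ z, ‖θ z‖ ≤ |C| := by
    intro z
    by_cases hz : ‖z‖ ≤ C
    · simpa [θ, hz] using hz.trans (le_abs_self C)
    · simp [θ, hz]
  refine ⟨⟨fun x => θ ((f : G → ℂ) x), ?_, |C|, Eventually.of_forall fun x => hb _⟩, |C|,
    fun x => hb _, ?_⟩
  · intro A hA F hF hF'
    exact hf _ (hθ hA) F hF hF'
  · rw [cls_eq_iff]
    filter_upwards [hC] with x hx
    simp [θ, hx]

variable [μ.IsAddHaarMeasure] [μ.Regular]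

omit [T2Space G] [μ.Regular] in
theorem exists_approximate_unit {O : Set G} (hO : O ∈ 𝓝 (0 : G)) :
    ∃ u : C(G, ℝ), HasCompactSupport u ∧ tsupport u ⊆ O ∧ (∀ x, 0 ≤ u x) ∧
      ∫ x, u x ∂μ = 1 := by
  obtain ⟨u, hu1, huc, huO, hu⟩ := exists_continuousMap_one_of_isCompact_subset_isOpen
    (isCompact_singleton (x := (0 : G))) isOpen_interior
    (Set.singleton_subset_iff.2 (mem_interior_iff_mem_nhds.2 hO))
  replace huc : HasCompactSupport u := huc
  have hpos : 0 < ∫ x, u x ∂μ :=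
    u.continuous.integral_pos_of_hasCompactSupport_nonneg_nonzero (x := 0) huc
      (fun x => (hu x).1) (by
        rw [hu1 rfl]
        exact one_ne_zero)
  have hsupp : tsupport ((∫ x, u x ∂μ)⁻¹ • u : C(G, ℝ)) ⊆ tsupport u :=
    closure_mono (Function.support_const_smul_subset _ _)
  refine ⟨(∫ x, u x ∂μ)⁻¹ • u, huc.of_isClosed_subset (isClosed_tsupport _) hsupp,
    (hsupp.trans huO).trans interior_subset, fun x => ?_, ?_⟩
  · exact mul_nonneg (inv_nonneg.2 hpos.le) (hu x).1
  · change ∫ x, (∫ x, u x ∂μ)⁻¹ * u x ∂μ = 1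
    rw [integral_const_mul, inv_mul_cancel₀ hpos.ne']

/-- Slowly oscillating functions are approximated at infinity by functions in `BUC(G)`. -/
theorem exists_mem_BUC_approx {f : LInfFun μ} {C : ℝ} (hC : ∀ x, ‖(f : G → ℂ) x‖ ≤ C)
    (hf : cls μ f ∈ SO μ) {ε : ℝ} (hε : 0 < ε) :
    ∃ K : Set G, IsCompact K ∧ ∃ g ∈ BUC G,
      ∀ᶠ x in lae μ, x ∉ K → ‖(f : G → ℂ) x - g x‖ ≤ ε := by
  -- Half of `ε` pays for the factor 2 in `eventually_norm_le_two_mul`.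
  obtain ⟨K, hK, O, hO, h⟩ := hf (ENNReal.ofReal (ε / 2)) (ENNReal.ofReal_pos.2 (half_pos hε))
  obtain ⟨u, huc, huO, hu0, hu1⟩ := exists_approximate_unit (μ := μ) hO
  have hcu : Continuous fun x => (u x : ℂ) := by fun_prop
  obtain ⟨g, hg, hgu⟩ := exists_mem_BUC_conv (μ := μ) f.2.1 hC hcu
    (huc.comp_left Complex.ofReal_zero)
  refine ⟨K, hK, g, hg, ?_⟩
  have hsub : LocMeasurable μ fun x => (f : G → ℂ) x - g x :=
    ((LInfFun μ).sub_mem f.2 (bcf_mem μ g)).1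
  have hbd : ∀ x, ‖(f : G → ℂ) x - g x‖ ≤ C + ‖g‖ := fun x =>
    (norm_sub_le _ _).trans (add_le_add (hC x) (g.norm_coe_le_norm x))
  have key := eventually_norm_le_two_mul hsub hbd hK.isClosed.isOpen_compl (ε := ε / 2)
    fun v hv hvK hv0 => by
      simp_rw [hgu]
      refine norm_integral_mul_sub_conv_le f.2.1 hC huc hv hu0 hv0 hu1 fun s hs => ?_
      have h1 := (h s (huO hs)).le
      rw [translate_cls, ← map_sub, normOn_cls_le_iff] at h1
      filter_upwards [h1] with x hx hxv
      have h2 : ‖(f : G → ℂ) x - (f : G → ℂ) (x - s)‖ₑ ≤ ENNReal.ofReal (ε / 2) := hx (hvK hxv)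
      rwa [← ofReal_norm, ENNReal.ofReal_le_ofReal_iff (half_pos hε).le] at h2
  filter_upwards [key] with x hx hxK
  exact (hx hxK).trans_eq (by ring)

theorem SO_subset_add : SO μ ⊆ BUCClass μ + BZero μ := by
  intro f' hf
  obtain ⟨f, C, hC, rfl⟩ := exists_bounded_representative f'
  have happ := fun n : ℕ => exists_mem_BUC_approx hC hf (ε := 1 / 2 ^ n) (by positivity)
  choose K hK g hg hfg using happ
  have hbump := fun n : ℕ => exists_bump ((hK n).union (hK (n + 1))) isOpen_univ
    (Set.subset_univ _)
  choose u ψ hψ hψu hu1 huc _ hu using hbump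
  -- The cutoff removes the correction exactly where `g n` or `g (n + 1)` is not known to
  -- approximate `f`.
  let d : ℕ → (G →ᵇ ℂ) := fun n => (g (n + 1) - g n) * (1 - ψ n)
  let S : ℕ → (G →ᵇ ℂ) := fun n => g 0 + ∑ k ∈ Finset.range n, d k
  have hd : ∀ n, d n ∈ BUC G := fun n =>
    mul_mem (sub_mem (hg _) (hg _)) (sub_mem (one_mem _) (hψ n))
  have hS : ∀ n, S n ∈ BUC G := fun n => add_mem (hg 0) (sum_mem fun k _ => hd k)
  have hdx : ∀ n x, d n x = (g (n + 1) x - g n x) * ((1 - u n x : ℝ) : ℂ) := by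
    intro n x
    rw [Complex.ofReal_sub, Complex.ofReal_one, ← hψu]
    rfl
  -- Both functions are near `f` locally almost everywhere there, hence near each other everywhere
  -- by continuity. The bound `2 / 2 ^ n` is written in the shape `C / 2 / 2 ^ n` of the geometric
  -- Cauchy criterion, with `C = 4`.
  have hgg : ∀ n, ∀ x ∈ (K n ∪ K (n + 1))ᶜ, ‖g (n + 1) x - g n x‖ ≤ 4 / 2 / 2 ^ n := by
    intro n
    refine le_of_eventually_lae (μ := μ) (by fun_prop)
      ((hK n).union (hK (n + 1))).isClosed.isOpen_compl ?_
    filter_upwards [hfg n, hfg (n + 1)] with x h1 h2 hx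
    have h1 := h1 fun h => hx (Or.inl h)
    have h2 := h2 fun h => hx (Or.inr h)
    have h3 := norm_sub_le ((f : G → ℂ) x - g n x) ((f : G → ℂ) x - g (n + 1) x)
    rw [sub_sub_sub_cancel_left] at h3
    have h4 : (1 : ℝ) / 2 ^ (n + 1) ≤ 1 / 2 ^ n :=
      one_div_le_one_div_of_le (by positivity) (pow_le_pow_right₀ one_le_two n.le_succ)
    have h5 : (4 : ℝ) / 2 / 2 ^ n = 1 / 2 ^ n + 1 / 2 ^ n := by ring
    linarith
  have hdn : ∀ n, ‖d n‖ ≤ 4 / 2 / 2 ^ n := by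
    intro n
    refine (BoundedContinuousFunction.norm_le (by positivity)).2 fun x => ?_
    rw [hdx]
    by_cases hx : x ∈ K n ∪ K (n + 1)
    · rw [hu1 n x hx, sub_self, Complex.ofReal_zero, mul_zero, norm_zero]
      positivity
    · rw [norm_mul, Complex.norm_real, Real.norm_eq_abs,
        abs_of_nonneg (sub_nonneg.2 (hu n x).2)]
      calc ‖g (n + 1) x - g n x‖ * (1 - u n x) ≤ 4 / 2 / 2 ^ n * 1 :=
            mul_le_mul (hgg n x hx) (by linarith [(hu n x).1]) (sub_nonneg.2 (hu n x).2)
              (by positivity)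
        _ = 4 / 2 / 2 ^ n := mul_one _
  have hSd : ∀ n, dist (S n) (S (n + 1)) ≤ 4 / 2 / 2 ^ n := by
    intro n
    rw [dist_comm, dist_eq_norm]
    simp only [S, Finset.sum_range_succ, ← add_assoc, add_sub_cancel_left]
    exact hdn n
  obtain ⟨H, hH⟩ := cauchySeq_tendsto_of_complete (cauchySeq_of_le_geometric_two hSd)
  have hHB : H ∈ BUC G := isClosed_BUC.mem_of_tendsto hH (Eventually.of_forall hS)
  let L : ℕ → Set G := fun n => ⋃ k ∈ Finset.range n, tsupport (u k)
  have hL : ∀ n, IsCompact (L n) := fun n => (Finset.range n).isCompact_biUnion fun k _ => huc k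
  -- Off the supports of the first `n` bumps no correction is cut off, and the sum telescopes.
  have hSg : ∀ n x, x ∉ L n → S n x = g n x := by
    intro n x hx
    have h1 : ∀ k ∈ Finset.range n, d k x = g (k + 1) x - g k x := by
      intro k hk
      have : u k x = 0 := image_eq_zero_of_notMem_tsupport fun h =>
        hx (Set.mem_iUnion₂.2 ⟨k, hk, h⟩)
      rw [hdx, this, sub_zero, Complex.ofReal_one, mul_one]
    have h2 : S n x = g 0 x + ∑ k ∈ Finset.range n, d k x := by
      simp [S]
    rw [h2, Finset.sum_congr rfl h1, Finset.sum_range_sub (fun k => g k x), add_sub_cancel]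
  refine Set.mem_add.2 ⟨bcfCls μ H, mem_BUCClass_iff.2 ⟨H, hHB, rfl⟩, cls μ f - bcfCls μ H, ?_,
    add_sub_cancel _ _⟩
  intro ε hε
  obtain ⟨δ, hδ, hδε⟩ := exists_ofReal_lt hε
  -- The error is `1 / 2 ^ n` from `f` to `g n = S n`, plus the tail `4 / 2 ^ n` from `S n` to `H`.
  obtain ⟨n, hn⟩ := exists_pow_lt_of_lt_one (show 0 < δ / 5 by positivity)
    (show (1 / 2 : ℝ) < 1 by norm_num)
  refine ⟨K n ∪ L n, (hK n).union (hL n), lt_of_le_of_lt ?_ hδε⟩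
  rw [bcfCls, ← map_sub, normOn_cls_le_iff]
  filter_upwards [hfg n] with x h1 hx
  have h1 := h1 fun h => hx (Or.inl h)
  have h2 := hSg n x fun h => hx (Or.inr h)
  have h3 : ‖S n x - H x‖ ≤ 4 / 2 ^ n := by
    rw [← dist_eq_norm]
    exact (BoundedContinuousFunction.dist_coe_le_dist x).trans
      (dist_le_of_le_geometric_two_of_tendsto hSd hH n)
  change ‖(f : G → ℂ) x - H x‖ₑ ≤ _
  rw [← ofReal_norm]
  refine ENNReal.ofReal_le_ofReal ?_
  rw [h2] at h3
  refine (norm_sub_le_norm_sub_add_norm_sub _ (g n x) _).trans ?_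
  rw [one_div_pow] at hn
  have h4 : (4 : ℝ) / 2 ^ n = 4 * (1 / 2 ^ n) := by ring
  linarith

end Decomposition

end LCA

end

theorem mainTheorem3 {G : Type*} [AddCommGroup G] [TopologicalSpace G] [IsTopologicalAddGroup G]
    [LocallyCompactSpace G] [T2Space G] [MeasurableSpace G] [BorelSpace G]
    (μ : Measure G) [μ.IsAddHaarMeasure] [μ.Regular] :
    LCA.SO μ = LCA.BUCClass μ + LCA.BZero μ ∧
      LCA.BUCClass μ + LCA.BZero μ = LCA.BUCOne μ := by
  have h : LCA.BUCClass μ + LCA.BZero μ ⊆ LCA.SO μ := by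
    rintro _ ⟨f, hf, g, hg, rfl⟩
    exact LCA.add_mem_SO (LCA.BUCClass_subset_SO hf) (LCA.BZero_subset_SO hg)
  exact ⟨LCA.SO_subset_add.antisymm h, LCA.add_subset_BUCOne.antisymm
    (LCA.BUCOne_subset_SO.trans LCA.SO_subset_add)⟩
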